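/- **Setting.** Consider $n$ complex parameters $x\in\mathbb C^n$ and a theory space $\mathcal T\subseteq\mathbb C^n$ that contains $\{D\neq 0\}$ for some entire function $D\not\equiv 0$; fix a base point $b\in\mathcal T$. The theory has a finite set of $v$ vacua and $m$ generating chiral operators $\mathcal O_1,\dots,\mathcal O_m$. Their expectation values $\langle i|\mathcal O_s|i\rangle$ are holomorphic near $b$ for each vacuum $i$, and different vacua are distinguished by the germs at $b$ of these functions. The *ring of parameters* $\mathsf a$ is a $\mathbb C$-algebra of entire functions on $\mathbb C^n$, with field of fractions $\mathsf k$ (the *field of parameters*). It is either the polynomial ring $\mathbb C[x_1,\dots,x_n]$ or, more generally, a ring such that every entire function integral over $\mathsf a$ lies in $\mathsf k$. A *chiral operator* is a polynomial $\mathcal O=\rho(\mathcal O_1,\dots,\mathcal O_m)$ with $\rho\in\mathsf a[X_1,\dots,X_m]$, and $\langle i|\mathcal O|i\rangle=\rho(\langle i|\mathcal O_1|i\rangle,\dots,\langle i|\mathcal O_m|i\rangle)$. The *chiral ring* is $\mathsf k[X_1,\dots,X_m]/\mathscr I$, where $\mathscr I$ is generated by all polynomials over $\mathsf a$ whose expectation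 value vanishes identically near $b$ in every vacuum. The *monodromy group* is the group of permutations of the vacua generated by those permutations $\sigma$ for which there is a closed loop in $\mathcal T$ based at $b$ along which, for every $i$ and $s$, the germ $\langle i|\mathcal O_s|i\rangle$ is analytically continued to the germ $\langle\sigma(i)|\mathcal O_s|\sigma(i)\rangle$. A *phase* is an orbit of the monodromy group on the set of vacua. **Theorem.** Suppose that the chiral ring is generated, as a $\mathsf k$-algebra, by a single chiral operator $\mathcal O$. Let $P_{\mathcal O}\in\mathsf a[X]$ be its polynomial: it has degree $v$, and $P_{\mathcal O}(\langle i|\mathcal O|i\rangle)=0$ near $b$ for every vacuum $i$. Then $P_{\mathcal O}$ is squarefree over $\mathsf k$, and there is a bijection $|p)\mapsto P_p$ from the set of phases onto the set of monic irreducible factors of $P_{\mathcal O}$ in $\mathsf k[X]$ such that, for every phase $|p)$: 1. a vacuum $i$ belongs to $|p)$ if and only if $\langle i|\mathcal O|i\rangle$ is a root of $P_p$; 2. the number of vacua in $|p)$ equals $\deg P_p$. -/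

import Mathlib

open Polynomial Topology Filter

noncomputable section

/-- The polynomial ring `ℂ[x₁, …, xₙ]` in the parameters, as a ring of functions on `ℂⁿ`. -/
def polynomialParameters (n : ℕ) : Subalgebra ℂ ((Fin n → ℂ) → ℂ) :=
  Algebra.adjoin ℂ (Set.range fun (k : Fin n) (x : Fin n → ℂ) => x k)

/-- Rings of parameters: rings `a` of entire functions of the `n` complex parameters that are
either the polynomial ring or, more generally, such that every entire function integral over `a`
is a quotient of elements of `a`. -/
structure IsRingOfParameters {n : ℕ} (a : Subalgebra ℂ ((Fin n → ℂ) → ℂ)) : Prop where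
  entire : ∀ f ∈ a, Differentiable ℂ f
  closed : a = polynomialParameters n ∨
    ∀ f : (Fin n → ℂ) → ℂ, Differentiable ℂ f → IsIntegral a f →
      ∃ c ∈ a, ∃ d ∈ a, d ≠ 0 ∧ d * f = c

/-- Evaluation of the elements of a ring of functions of the parameters at a point `x`. -/
def evalParam {n : ℕ} (a : Subalgebra ℂ ((Fin n → ℂ) → ℂ)) (x : Fin n → ℂ) : a →+* ℂ :=
  (Pi.evalRingHom (fun _ : Fin n → ℂ => ℂ) x).comp a.val.toRingHom

/-- `F t`, considered near `γ t`, is a holomorphic function element for every `t`, and these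
function elements are analytic continuations of one another along the path `γ`. -/
def IsAnalyticContinuation {n : ℕ} {x y : Fin n → ℂ} (γ : Path x y)
    (F : unitInterval → (Fin n → ℂ) → ℂ) : Prop :=
  (∀ t, ∀ᶠ z in 𝓝 (γ t), DifferentiableAt ℂ (F t) z) ∧
    ∀ t, ∀ᶠ s in 𝓝 t, F s =ᶠ[𝓝 (γ s)] F t

/-- The chiral sector of a theory with `n` complex parameters, set of vacua `Vac` and `m`
generating chiral operators: the theory space (all parameter values, except possibly some of
those in a proper analytic hypersurface), a base point in it, and the expectation values
`vev s i` of the `s`-th generator in the vacuum `i`, holomorphic functions of the parameters near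
the base point, such that distinct vacua are distinguished by some expectation value. -/
structure ChiralSector (n m : ℕ) (Vac : Type*) where
  theorySpace : Set (Fin n → ℂ)
  generic : ∃ D : (Fin n → ℂ) → ℂ, Differentiable ℂ D ∧ D ≠ 0 ∧ ∀ x, D x ≠ 0 → x ∈ theorySpace
  base : Fin n → ℂ
  base_mem : base ∈ theorySpace
  vev : Fin m → Vac → (Fin n → ℂ) → ℂ
  holomorphic : ∀ s i, ∀ᶠ x in 𝓝 base, DifferentiableAt ℂ (vev s i) x
  separated : ∀ i j, (∀ s, vev s i =ᶠ[𝓝 base] vev s j) → i = j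

namespace ChiralSector

variable {n m : ℕ} {Vac : Type*} (T : ChiralSector n m Vac)

/-- The monodromy group: generated by the permutations `σ` of the vacua for which there is a
closed loop in theory space along which, for every vacuum `i`, the expectation values in the
vacuum `i` are analytically continued to those in the vacuum `σ i`. -/
def monodromyGroup : Subgroup (Equiv.Perm Vac) :=
  Subgroup.closure {σ | ∃ γ : Path T.base T.base, (∀ t, γ t ∈ T.theorySpace) ∧
    ∀ i s, ∃ F : unitInterval → (Fin n → ℂ) → ℂ, IsAnalyticContinuation γ F ∧
      F 0 =ᶠ[𝓝 T.base] T.vev s i ∧ F 1 =ᶠ[𝓝 T.base] T.vev s (σ i)}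

/-- The phases: orbits of the monodromy group on the set of vacua. -/
abbrev Phase : Type _ := MulAction.orbitRel.Quotient T.monodromyGroup Vac

variable (a : Subalgebra ℂ ((Fin n → ℂ) → ℂ))

/-- The expectation value, in the vacuum `i`, of the chiral operator `ρ(𝒪₁, …, 𝒪ₘ)`, where `ρ`
is a polynomial with coefficients in the ring of parameters `a`. -/
def expectation (ρ : MvPolynomial (Fin m) a) (i : Vac) (x : Fin n → ℂ) : ℂ :=
  MvPolynomial.eval₂ (evalParam a x) (fun s => T.vev s i x) ρ

/-- The ideal of operator relations: polynomials in the generators, with coefficients in `a`,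
whose expectation value vanishes identically in every vacuum. -/
def relations : Ideal (MvPolynomial (Fin m) a) where
  carrier := {ρ | ∀ i, ∀ᶠ x in 𝓝 T.base, T.expectation a ρ i x = 0}
  zero_mem' := fun i => Eventually.of_forall fun x => by simp [expectation]
  add_mem' := fun {ρ τ} hρ hτ i => by
    filter_upwards [hρ i, hτ i] with x h1 h2
    simp only [expectation, MvPolynomial.eval₂_add] at *
    rw [h1, h2, add_zero]
  smul_mem' := fun ρ τ hτ i => by
    filter_upwards [hτ i] with x h
    simp only [expectation, smul_eq_mul, MvPolynomial.eval₂_mul] at *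
    rw [h, mul_zero]

variable (K : Type*) [Field K] [Algebra a K]

/-- The chiral ring `K[X₁, …, Xₘ] / I` over the field of parameters `K`, where `I` is generated
by the operator relations. -/
abbrev ChiralRing : Type _ :=
  MvPolynomial (Fin m) K ⧸ (T.relations a).map (MvPolynomial.map (algebraMap a K))

/-- The element of the chiral ring defined by the chiral operator `ρ(𝒪₁, …, 𝒪ₘ)`. -/
def toChiralRing (ρ : MvPolynomial (Fin m) a) : T.ChiralRing a K :=
  Ideal.Quotient.mk _ (MvPolynomial.map (algebraMap a K) ρ)

variable {K}

/-- Near the base point, the function `f` is identically a root of the polynomial `p`, whose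
coefficients are quotients of elements of `a` (denominators are cleared before evaluating). -/
def IsRootNearBase (p : K[X]) (f : (Fin n → ℂ) → ℂ) : Prop :=
  ∃ d : a, d ≠ 0 ∧ ∃ Q : a[X], Q.map (algebraMap a K) = C (algebraMap a K d) * p ∧
    ∀ᶠ x in 𝓝 T.base, (Q.map (evalParam a x)).eval (f x) = 0

end ChiralSector

end

/-!
Write `fᵢ` for the germ at the base point of the expectation value of `O` in the vacuum `i`. Since
`O` generates the chiral ring, every generator is, up to a denominator, a polynomial in `O` modulo
the relations; so the `fᵢ` are distinct, and they are all the roots of `P` in the field `M` of germs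
of meromorphic functions at the base point, which contains `K`. In particular `P` is separable
(`separable_and_splits_of_injective_roots`).

The theorem is then Galois theory, with the monodromy group in the place of the Galois group: the
phase of `i` corresponds to the minimal polynomial of `fᵢ` over `K`
(`exists_orbit_equiv_factors`). Two facts are needed.

* Monodromy preserves algebraic relations over `K`, by permanence of functional relations under
  analytic continuation (`ChiralSector.isRootNearBase_monodromy_iff`).
* Monodromy is transitive on the roots of an irreducible factor
  (`ChiralSector.exists_polynomial_of_orbit`). Outside the zeros of an entire function `D`, the
  theory is regular and the roots of `P` are, locally, holomorphic functions of the parameters.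
  The values of all the continuations of `fᵢ` to `x` form a set of roots of `P` at `x`, the sheet
  of `i`, that locally consists of the values of some of these functions. Symmetric functions of the
  sheet are therefore single-valued and holomorphic where `D ≠ 0`; multiplied by the leading
  coefficient of `P`, the roots are integral over `a`, hence locally bounded, so that these symmetric
  functions extend to entire functions integral over `a`
  (`ChiralSector.RegularLocus.exists_entire_sheetProduct`), and they belong to `K` by the condition
  on rings of parameters. Near the base point the sheet consists of the `fⱼ` with `j` in the orbit
  of `i` (`ChiralSector.RegularLocus.exists_finset_orbit`), so that a polynomial over `K` with root
  `fᵢ` has no roots `fⱼ` outside the orbit.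

The symmetric functions used are the products `∏ (lam - c fⱼ)` for numbers `lam`; the coefficients
of the polynomial `∏ (X - c fⱼ)` are obtained from them by Lagrange interpolation.

From several complex variables, Riemann's extension theorem (`exists_entire_extension`) and the
identity theorem on balls are proved by restriction to complex lines. That the polynomial ring
satisfies the condition on integral entire functions is a form of Liouville's theorem
(`mem_polynomialParameters_of_growth`).
-/

open Polynomial Topology Filter

noncomputable section

/-! ### Holomorphic functions of several variables -/

section SeveralVariables

variable {E : Type*} [NormedAddCommGroup E] [NormedSpace ℂ E]

/-- Identity theorem on a ball: restricting to complex lines through a point near which the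
function vanishes reduces it to one variable. -/
theorem eq_zero_of_eventuallyEq_zero_of_ball {f : E → ℂ} {c z₀ : E} {r : ℝ}
    (hf : ∀ z ∈ Metric.ball c r, DifferentiableAt ℂ f z) (hz₀ : z₀ ∈ Metric.ball c r)
    (h0 : f =ᶠ[𝓝 z₀] 0) {z : E} (hz : z ∈ Metric.ball c r) : f z = 0 := by
  set l : ℂ → E := fun w => z₀ + w • (z - z₀) with hl
  have hlc : Continuous l := by fun_prop
  have hld : Differentiable ℂ l := by fun_prop
  set U : Set ℂ := l ⁻¹' Metric.ball c r
  have hUo : IsOpen U := Metric.isOpen_ball.preimage hlc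
  have hUc : IsPreconnected U := by
    refine Convex.isPreconnected ?_
    intro x hx y hy s t hs ht hst
    have : l (s • x + t • y) = s • l x + t • l y := by
      have h1 : (s : ℂ) + t = 1 := by exact_mod_cast hst
      simp only [hl, ← Complex.coe_smul, smul_add, add_smul, smul_smul, smul_eq_mul]
      have : z₀ = ((s : ℂ) + t) • z₀ := by rw [h1, one_smul]
      nth_rewrite 1 [this]
      rw [add_smul]
      abel
    change l _ ∈ Metric.ball c r
    rw [this]
    exact (convex_ball c r) hx hy hs ht hst
  have hd : DifferentiableOn ℂ (f ∘ l) U := fun w hw =>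
    ((hf _ hw).comp w (hld w)).differentiableWithinAt
  have h0U : (0 : ℂ) ∈ U := by simpa [U, hl] using hz₀
  have hev : (f ∘ l) =ᶠ[𝓝 0] 0 := by
    have : Tendsto l (𝓝 0) (𝓝 z₀) := by simpa [hl] using hlc.tendsto 0
    exact this.eventually h0
  have := (hd.analyticOnNhd hUo).eqOn_zero_of_preconnected_of_eventuallyEq_zero hUc h0U hev
    (show (1 : ℂ) ∈ U by simpa [U, hl] using hz)
  simpa [hl] using this

theorem eq_of_eventuallyEq_of_ball {f g : E → ℂ} {c z₀ : E} {r : ℝ}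
    (hf : ∀ z ∈ Metric.ball c r, DifferentiableAt ℂ f z)
    (hg : ∀ z ∈ Metric.ball c r, DifferentiableAt ℂ g z) (hz₀ : z₀ ∈ Metric.ball c r)
    (h : f =ᶠ[𝓝 z₀] g) {z : E} (hz : z ∈ Metric.ball c r) : f z = g z := by
  have := eq_zero_of_eventuallyEq_zero_of_ball (f := f - g)
    (fun z hz => (hf z hz).sub (hg z hz)) hz₀
    (h.mono fun x hx => by simp [hx]) hz
  exact sub_eq_zero.1 this

theorem Differentiable.eq_zero_of_eventuallyEq_zero {f : E → ℂ} (hf : Differentiable ℂ f) {z₀ : E}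
    (h0 : f =ᶠ[𝓝 z₀] 0) : f = 0 := by
  funext z
  refine eq_zero_of_eventuallyEq_zero_of_ball (c := z₀) (r := ‖z - z₀‖ + 1) (fun z _ => hf z) ?_
    h0 ?_
  · simpa using (by positivity : 0 < ‖z - z₀‖ + 1)
  · simp [dist_eq_norm]

/-- Germs of holomorphic functions have no zero divisors. -/
theorem eventuallyEq_zero_or_of_mul {f g : E → ℂ} {c : E}
    (hf : ∀ᶠ z in 𝓝 c, DifferentiableAt ℂ f z) (hg : ∀ᶠ z in 𝓝 c, DifferentiableAt ℂ g z)
    (h : ∀ᶠ z in 𝓝 c, f z * g z = 0) : f =ᶠ[𝓝 c] 0 ∨ g =ᶠ[𝓝 c] 0 := by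
  obtain ⟨r, hr, hB⟩ := Metric.eventually_nhds_iff_ball.1 (hf.and (hg.and h))
  by_cases hz : ∀ z ∈ Metric.ball c r, f z = 0
  · exact Or.inl (Filter.mem_of_superset (Metric.ball_mem_nhds c hr) hz)
  push Not at hz
  obtain ⟨z, hz, hfz⟩ := hz
  have hg0 : g =ᶠ[𝓝 z] 0 := by
    filter_upwards [(hB z hz).1.continuousAt.eventually_ne hfz,
      Metric.isOpen_ball.mem_nhds hz] with y hy hyB
    exact (mul_eq_zero.1 (hB y hyB).2.2).resolve_left hy
  exact Or.inr (Filter.mem_of_superset (Metric.ball_mem_nhds c hr) fun y hy =>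
    eq_zero_of_eventuallyEq_zero_of_ball (fun z hz => (hB z hz).2.1) hz hg0 hy)

theorem Differentiable.dense_ne_zero {D : E → ℂ} (hD : Differentiable ℂ D) (h0 : D ≠ 0) :
    Dense {x | D x ≠ 0} := by
  suffices interior {x | D x = 0} = ∅ from interior_eq_empty_iff_dense_compl.1 this
  by_contra hne
  obtain ⟨z, hz⟩ := Set.nonempty_iff_ne_empty.2 hne
  exact h0 (hD.eq_zero_of_eventuallyEq_zero (mem_interior_iff_mem_nhds.1 hz))

/-- On a complex line that is not contained in it, the zero set of an entire function is
discrete. -/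
theorem Differentiable.eventually_ne_zero_on_line {D : E → ℂ} (hD : Differentiable ℂ D)
    {x₀ v : E} {w₀ : ℂ} (hv : D (x₀ + w₀ • v) ≠ 0) (c : ℂ) : ∀ᶠ w in 𝓝[≠] c, D (x₀ + w • v) ≠ 0 := by
  have hd : Differentiable ℂ (fun w : ℂ => D (x₀ + w • v)) := hD.comp (by fun_prop)
  rcases (hd.analyticAt c).eventually_eq_zero_or_eventually_ne_zero with h | h
  · have := hd.eq_zero_of_eventuallyEq_zero h
    exact absurd (by simpa using congrFun this w₀) hv
  · exact h

end SeveralVariables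

/-! ### Removable singularities in several variables -/

/-- A function of one variable, bounded and holomorphic off the zeros of a nonzero entire function,
has the mean value property about a non-zero of that function. -/
theorem circleIntegral_of_bounded_off_zeros {g D : ℂ → ℂ} (hD : ∀ c, ∀ᶠ w in 𝓝[≠] c, D w ≠ 0)
    (hDc : Continuous D)
    {r C : ℝ} (hr : 0 < r) (hg : ∀ w ∈ Metric.closedBall (0 : ℂ) r, D w ≠ 0 → DifferentiableAt ℂ g w)
    (hb : ∀ w ∈ Metric.ball (0 : ℂ) r, D w ≠ 0 → ‖g w‖ ≤ C)
    (h0 : D 0 ≠ 0) (hs : ∀ w ∈ Metric.sphere (0 : ℂ) r, D w ≠ 0) :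
    (∮ w in C(0, r), w⁻¹ • g w) = (2 * Real.pi * Complex.I) • g 0 := by
  classical
  set h : ℂ → ℂ := fun w => if D w = 0 then limUnder (𝓝[≠] w) g else g w with hh
  have hgh : ∀ w, D w ≠ 0 → h =ᶠ[𝓝 w] g := fun w hw => by
    filter_upwards [hDc.continuousAt.eventually_ne hw] with y hy
    simp [hh, hy]
  have hd : ∀ w ∈ Metric.closedBall (0 : ℂ) r, DifferentiableAt ℂ h w := by
    intro w hw
    by_cases hDw : D w = 0
    · have hwb : w ∈ Metric.ball (0 : ℂ) r := by
        rcases (Metric.mem_closedBall.1 hw).lt_or_eq with h1 | h1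
        · exact h1
        · exact absurd hDw (hs w h1)
      have hN : ∀ᶠ y in 𝓝 w, y ∈ Metric.ball (0 : ℂ) r ∧ (y ≠ w → D y ≠ 0) :=
        (show ∀ᶠ y in 𝓝 w, y ∈ Metric.ball (0 : ℂ) r from
          Metric.isOpen_ball.mem_nhds hwb).and
          (eventually_nhdsWithin_iff.1 (hD w))
      have key := Complex.differentiableOn_update_limUnder_of_bddAbove (f := g) (c := w) hN
        (fun y hy => (hg y (Metric.ball_subset_closedBall hy.1.1)
          (hy.1.2 hy.2)).differentiableWithinAt)
        ⟨C, by
          rintro _ ⟨y, hy, rfl⟩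
          exact hb y hy.1.1 (hy.1.2 hy.2)⟩
      refine (key.differentiableAt hN).congr_of_eventuallyEq ?_
      filter_upwards [hN] with y hy
      by_cases hyw : y = w
      · subst hyw; simp [hh, hDw]
      · simp [hh, hyw, hy.2 hyw]
    · exact (hg w hw hDw).congr_of_eventuallyEq (hgh w hDw)
  have key := Complex.circleIntegral_sub_center_inv_smul_of_differentiable_on_off_countable hr
    (Set.countable_empty) (f := h) (c := 0)
    (fun w hw => (hd w hw).continuousAt.continuousWithinAt)
    (fun w hw => hd w (Metric.ball_subset_closedBall hw.1))
  rw [(hgh 0 h0).eq_of_nhds] at key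
  rw [← key]
  refine circleIntegral.integral_congr hr.le fun w hw => ?_
  simp [hh, hs w hw]

section Removable

variable {n : ℕ}

/-- Differentiation under the integral sign for the circle averages of a function holomorphic on
an open set. -/
theorem differentiableAt_circleIntegral {U : Set (Fin n → ℂ)} (hU : IsOpen U)
    {G : (Fin n → ℂ) → ℂ} (hG : ∀ x ∈ U, DifferentiableAt ℂ G x) {x₀ v : Fin n → ℂ} {r : ℝ}
    (hr : 0 < r) (hx₀ : ∀ w ∈ Metric.sphere (0 : ℂ) r, x₀ + w • v ∈ U) :
    DifferentiableAt ℂ (fun x => ∮ w in C(0, r), w⁻¹ • G (x + w • v)) x₀ := by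
  set K : Set (Fin n → ℂ) := (fun w : ℂ => x₀ + w • v) '' Metric.sphere (0 : ℂ) r with hK
  have hKc : IsCompact K := (isCompact_sphere (0 : ℂ) r).image (by fun_prop)
  have hKU : K ⊆ U := by rintro _ ⟨w, hw, rfl⟩; exact hx₀ w hw
  obtain ⟨δ, hδ, hδU⟩ := hKc.exists_cthickening_subset_open hU hKU
  have hK'c : IsCompact (Metric.cthickening δ K) := hKc.cthickening
  have hGc : ContinuousOn G (Metric.cthickening δ K) :=
    fun x hx => (hG x (hδU hx)).continuousAt.continuousWithinAt
  obtain ⟨M, hM⟩ := hK'c.exists_bound_of_continuousOn hGc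
  have hmem : ∀ x ∈ Metric.ball x₀ (δ / 2), ∀ w ∈ Metric.sphere (0 : ℂ) r,
      Metric.ball (x + w • v) (δ / 2) ⊆ Metric.cthickening δ K := by
    intro x hx w hw y hy
    refine Metric.mem_cthickening_of_dist_le y (x₀ + w • v) δ K ⟨w, hw, rfl⟩ ?_
    have h1 : dist (x + w • v) (x₀ + w • v) < δ / 2 := by simpa using hx
    have := dist_triangle y (x + w • v) (x₀ + w • v)
    rw [Metric.mem_ball] at hy
    linarith
  have hM0 : ∀ x ∈ Metric.ball x₀ (δ / 2), ∀ w ∈ Metric.sphere (0 : ℂ) r,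
      ‖fderiv ℂ G (x + w • v)‖ ≤ (M + M) / (δ / 2) := by
    intro x hx w hw
    refine Complex.norm_fderiv_le_div_of_mapsTo_ball
      (fun y hy => (hG y (hδU (hmem x hx w hw hy))).differentiableWithinAt) ?_ (by positivity)
    intro y hy
    rw [Metric.mem_closedBall, dist_eq_norm]
    exact (norm_sub_le _ _).trans (add_le_add (hM _ (hmem x hx w hw hy))
      (hM _ (hmem x hx w hw (Metric.mem_ball_self (by positivity)))))
  have hin : ∀ x ∈ Metric.ball x₀ (δ / 2), ∀ w ∈ Metric.sphere (0 : ℂ) r, x + w • v ∈ U :=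
    fun x hx w hw => hδU (hmem x hx w hw (Metric.mem_ball_self (by positivity)))
  have hcm : ∀ θ : ℝ, circleMap 0 r θ ∈ Metric.sphere (0 : ℂ) r :=
    fun θ => circleMap_mem_sphere 0 hr.le θ
  have hcne : ∀ θ : ℝ, circleMap 0 r θ ≠ 0 := fun θ => by simpa using hr.ne'
  have hcont : ∀ x ∈ Metric.ball x₀ (δ / 2), Continuous fun θ : ℝ =>
      deriv (circleMap 0 r) θ • (circleMap 0 r θ)⁻¹ • G (x + circleMap 0 r θ • v) := by
    intro x hx
    have hG' : Continuous fun θ : ℝ => G (x + circleMap 0 r θ • v) := by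
      refine continuous_iff_continuousAt.2 fun θ => ?_
      refine ContinuousAt.comp (f := fun θ : ℝ => x + circleMap 0 r θ • v)
        (hG _ (hin x hx _ (hcm θ))).continuousAt ?_
      have := continuous_circleMap 0 r
      fun_prop
    have h1 : Continuous fun θ : ℝ => (circleMap 0 r θ)⁻¹ :=
      (continuous_circleMap 0 r).inv₀ hcne
    have h2 : Continuous fun θ : ℝ => deriv (circleMap 0 r) θ := by
      simp only [deriv_circleMap]
      have := continuous_circleMap 0 r
      fun_prop
    exact h2.smul (h1.smul hG')
  have hball : Metric.ball x₀ (δ / 2) ∈ 𝓝 x₀ := Metric.ball_mem_nhds _ (by positivity)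
  refine HasFDerivAt.differentiableAt (intervalIntegral.hasFDerivAt_integral_of_dominated_of_fderiv_le
    (μ := MeasureTheory.volume) (a := 0) (b := 2 * Real.pi) (𝕜 := ℂ)
    (F := fun x θ => deriv (circleMap 0 r) θ • (circleMap 0 r θ)⁻¹ • G (x + circleMap 0 r θ • v))
    (F' := fun x θ => deriv (circleMap 0 r) θ • (circleMap 0 r θ)⁻¹ •
      fderiv ℂ G (x + circleMap 0 r θ • v))
    (bound := fun _ => r * (r⁻¹ * ((M + M) / (δ / 2)))) hball ?_ ?_ ?_ ?_ ?_ ?_)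
  · filter_upwards [hball] with x hx
    exact (hcont x hx).aestronglyMeasurable
  · exact (hcont x₀ (Metric.mem_ball_self (by positivity))).intervalIntegrable _ _
  · refine Measurable.aestronglyMeasurable ?_
    have h3 : Measurable fun θ : ℝ => fderiv ℂ G (x₀ + circleMap 0 r θ • v) := by
      refine (measurable_fderiv ℂ G).comp ?_
      refine Continuous.measurable ?_
      have := continuous_circleMap 0 r
      fun_prop
    have h1 : Continuous fun θ : ℝ => (circleMap 0 r θ)⁻¹ :=
      (continuous_circleMap 0 r).inv₀ hcne
    have h2 : Continuous fun θ : ℝ => deriv (circleMap 0 r) θ := by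
      simp only [deriv_circleMap]
      have := continuous_circleMap 0 r
      fun_prop
    exact h2.measurable.smul (h1.measurable.smul h3)
  · refine Eventually.of_forall fun θ _ x hx => ?_
    rw [norm_smul, norm_smul, deriv_circleMap]
    have := hM0 x hx _ (hcm θ)
    simp only [norm_mul, norm_circleMap_zero, Complex.norm_I, mul_one, norm_inv, abs_of_pos hr]
    gcongr
  · exact intervalIntegrable_const
  · refine Eventually.of_forall fun θ _ x hx => ?_
    have := (hG _ (hin x hx _ (hcm θ))).hasFDerivAt
    have h := this.comp x ((hasFDerivAt_id x).add_const (circleMap 0 r θ • v))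
    rw [ContinuousLinearMap.comp_id] at h
    exact (h.const_smul (circleMap 0 r θ)⁻¹).const_smul (deriv (circleMap 0 r) θ)

/-- Riemann's extension theorem: a holomorphic function on the complement of the zeros of a nonzero
entire function that is locally bounded near these zeros extends to an entire function. Locally,
the extension is the circle average along a complex line not contained in the zero set. -/
theorem exists_entire_extension {D G : (Fin n → ℂ) → ℂ} (hD : Differentiable ℂ D) (h0 : D ≠ 0)
    (hG : ∀ x, D x ≠ 0 → DifferentiableAt ℂ G x)
    (hb : ∀ x₀, ∃ C : ℝ, ∀ᶠ x in 𝓝 x₀, D x ≠ 0 → ‖G x‖ ≤ C) :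
    ∃ g : (Fin n → ℂ) → ℂ, Differentiable ℂ g ∧ ∀ x, D x ≠ 0 → g x = G x := by
  have hU : IsOpen {x | D x ≠ 0} := isOpen_ne_fun hD.continuous continuous_const
  have hloc : ∀ x₀, ∃ H : (Fin n → ℂ) → ℂ, ∀ᶠ x in 𝓝 x₀, DifferentiableAt ℂ H x ∧
      (D x ≠ 0 → H x = G x) := by
    intro x₀
    obtain ⟨z, hz⟩ : ∃ z, D z ≠ 0 := by
      by_contra h
      push Not at h
      exact h0 (funext h)
    set v := z - x₀ with hv
    obtain ⟨C, hC⟩ := hb x₀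
    have hline := hD.eventually_ne_zero_on_line (x₀ := x₀) (v := v) (w₀ := 1)
      (by simpa [hv] using hz) 0
    have hC' : ∀ᶠ p : (Fin n → ℂ) × ℂ in 𝓝 (x₀, 0), D (p.1 + p.2 • v) ≠ 0 →
        ‖G (p.1 + p.2 • v)‖ ≤ C := by
      have : Tendsto (fun p : (Fin n → ℂ) × ℂ => p.1 + p.2 • v) (𝓝 (x₀, 0)) (𝓝 x₀) := by
        have h : Continuous (fun p : (Fin n → ℂ) × ℂ => p.1 + p.2 • v) := by fun_prop
        simpa using h.tendsto (x₀, 0)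
      exact this.eventually hC
    rw [nhds_prod_eq] at hC'
    obtain ⟨pa, hpa, pb, hpb, hab⟩ := eventually_prod_iff.1 hC'
    obtain ⟨r, hr, hball⟩ := Metric.eventually_nhds_iff_ball.1
      (hpb.and (eventually_nhdsWithin_iff.1 hline))
    have hr2 : 0 < r / 2 := by positivity
    have hsub : ∀ w ∈ Metric.closedBall (0 : ℂ) (r / 2), w ∈ Metric.ball (0 : ℂ) r :=
      fun w hw => Metric.closedBall_subset_ball (by linarith) hw
    have hsph : ∀ w ∈ Metric.sphere (0 : ℂ) (r / 2), D (x₀ + w • v) ≠ 0 := by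
      intro w hw
      refine (hball w (hsub w (Metric.sphere_subset_closedBall hw))).2 ?_
      rintro rfl
      simp at hw
      linarith
    have htube : ∀ᶠ x in 𝓝 x₀, ∀ w ∈ Metric.sphere (0 : ℂ) (r / 2), D (x + w • v) ≠ 0 := by
      refine (isCompact_sphere (0 : ℂ) (r / 2)).eventually_forall_of_forall_eventually ?_
      intro w hw
      have h : Continuous (fun p : (Fin n → ℂ) × ℂ => D (p.1 + p.2 • v)) :=
        hD.continuous.comp (by fun_prop)
      exact h.continuousAt.eventually_ne (hsph w hw)
    refine ⟨fun x => (2 * Real.pi * Complex.I : ℂ)⁻¹ • ∮ w in C(0, r / 2), w⁻¹ • G (x + w • v), ?_⟩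
    filter_upwards [htube, hpa] with x hx hxa
    refine ⟨(differentiableAt_circleIntegral hU hG hr2 hx).const_smul
      (2 * Real.pi * Complex.I : ℂ)⁻¹, fun hDx => ?_⟩
    have hl : Differentiable ℂ fun w : ℂ => x + w • v := by fun_prop
    rw [circleIntegral_of_bounded_off_zeros (D := fun w => D (x + w • v))
      (g := fun w => G (x + w • v)) (C := C)
      (fun c => hD.eventually_ne_zero_on_line (w₀ := 0) (by simpa using hDx) c)
      (hD.continuous.comp hl.continuous) hr2
      (fun w _ hw => (hG _ hw).comp w (hl w))
      (fun w hw hDw => hab hxa (hball w (hsub w (Metric.ball_subset_closedBall hw))).1 hDw)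
      (by simpa using hDx) hx, inv_smul_smul₀]
    · simp
    · simp [Real.pi_ne_zero, Complex.I_ne_zero]
  have hdense := hD.dense_ne_zero h0
  have hext : ∀ x (H : (Fin n → ℂ) → ℂ), DifferentiableAt ℂ H x →
      (∀ᶠ y in 𝓝 x, D y ≠ 0 → H y = G y) → extendFrom {x | D x ≠ 0} G x = H x := by
    intro x H hH hHG
    refine extendFrom_eq (hdense x) ?_
    refine (hH.continuousAt.tendsto.mono_left nhdsWithin_le_nhds).congr' ?_
    exact eventually_nhdsWithin_iff.2 hHG
  refine ⟨extendFrom {x | D x ≠ 0} G, fun x₀ => ?_, fun x hx => ?_⟩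
  · obtain ⟨H, hH⟩ := hloc x₀
    refine hH.self_of_nhds.1.congr_of_eventuallyEq ?_
    filter_upwards [hH, eventually_eventually_nhds.2 hH] with x hx hx'
    exact hext x H hx.1 (hx'.mono fun y hy => hy.2)
  · exact hext x G (hG x hx) (Eventually.of_forall fun _ _ => rfl)

end Removable

/-! ### Entire functions integral over a ring of parameters -/

/-- The roots of a monic polynomial are bounded in terms of its coefficients. -/
theorem Polynomial.Monic.norm_root_le {p : ℂ[X]} (hp : p.Monic) {z : ℂ} (hz : p.eval z = 0) :
    ‖z‖ ≤ 1 + ∑ k ∈ Finset.range p.natDegree, ‖p.coeff k‖ := by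
  have h := NNReal.coe_le_coe.2 (IsRoot.norm_lt_cauchyBound hp.ne_zero hz).le
  refine h.trans ?_
  rw [cauchyBound, hp.leadingCoeff]
  have : Finset.sup (Finset.range p.natDegree) (fun x => ‖p.coeff x‖₊) ≤
      ∑ k ∈ Finset.range p.natDegree, ‖p.coeff k‖₊ :=
    Finset.sup_le fun k hk => Finset.single_le_sum (f := fun k => ‖p.coeff k‖₊)
      (fun _ _ => zero_le) hk
  have h2 : ((Finset.sup (Finset.range p.natDegree) (fun x => ‖p.coeff x‖₊) : NNReal) : ℝ) ≤
      ∑ k ∈ Finset.range p.natDegree, ‖p.coeff k‖ := by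
    have := NNReal.coe_le_coe.2 this
    push_cast at this
    simpa using this
  push_cast
  rw [norm_one, div_one]
  linarith

/-- An entire function of one variable of polynomial growth is recovered from its values at
`0, …, M` by Lagrange interpolation. -/
theorem Differentiable.eq_sum_lagrange_of_growth {g : ℂ → ℂ} (hg : Differentiable ℂ g) {C : ℝ}
    {M : ℕ} (hC : ∀ t, ‖g t‖ ≤ C * (1 + ‖t‖) ^ M) (t : ℂ) :
    g t = ∑ j ∈ Finset.range (M + 1), g j *
      (Lagrange.basis (Finset.range (M + 1)) (fun j : ℕ => (j : ℂ)) j).eval t := by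
  have hC0 : 0 ≤ C := by
    have := (norm_nonneg _).trans (hC 0)
    simpa using this
  have hz : ∀ k, M < k → iteratedDeriv k g 0 = 0 := by
    intro k hk
    have hlim : Tendsto (fun R : ℝ => k.factorial * (C * 2 ^ M) / R) atTop (𝓝 0) :=
      tendsto_const_nhds.div_atTop tendsto_id
    rw [← norm_le_zero_iff]
    refine ge_of_tendsto hlim ?_
    filter_upwards [eventually_ge_atTop 1] with R hR
    have hR0 : 0 < R := by linarith
    have := Complex.norm_iteratedDeriv_le_of_forall_mem_sphere_norm_le (c := 0) (R := R)
      (C := C * (2 * R) ^ M) k hR0 hg.diffContOnCl (fun z hz => by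
        refine (hC z).trans ?_
        have : ‖z‖ = R := by simpa using hz
        rw [this]
        gcongr
        linarith)
    refine this.trans ?_
    rw [div_le_div_iff₀ (by positivity) hR0]
    have h1 : R ^ M * R ≤ R ^ k := by
      rw [← pow_succ]; exact pow_le_pow_right₀ hR hk
    calc k.factorial * (C * (2 * R) ^ M) * R = k.factorial * (C * 2 ^ M) * (R ^ M * R) := by ring
      _ ≤ k.factorial * (C * 2 ^ M) * R ^ k := by gcongr
  set q : ℂ[X] := ∑ k ∈ Finset.range (M + 1),
    Polynomial.C ((k.factorial : ℂ)⁻¹ * iteratedDeriv k g 0) * X ^ k with hq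
  have hqg : ∀ t, q.eval t = g t := by
    intro t
    rw [← Complex.taylorSeries_eq_of_entire' 0 t hg, tsum_eq_sum (s := Finset.range (M + 1))]
    · simp [hq, eval_finsetSum]
    · intro k hk
      rw [hz k (by simpa [Nat.lt_succ_iff] using hk)]
      simp
  have hdeg : q.degree < ((Finset.range (M + 1)).card : WithBot ℕ) := by
    rw [Finset.card_range]
    refine (degree_sum_le _ _).trans_lt ?_
    refine (Finset.sup_lt_iff (WithBot.bot_lt_coe _)).2 fun k hk => ?_
    refine (degree_C_mul_X_pow_le _ _).trans_lt ?_
    exact_mod_cast Finset.mem_range.1 hk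
  have hI := Lagrange.eq_interpolate_of_eval_eq (s := Finset.range (M + 1))
    (v := fun j : ℕ => (j : ℂ)) (fun j => g j) (Nat.cast_injective.injOn) hdeg
    (fun i _ => hqg i)
  rw [← hqg t, hI, Lagrange.interpolate_apply, eval_finsetSum]
  simp

section PolynomialParameters

variable {n : ℕ}

theorem exists_growth_of_mem_polynomialParameters {f : (Fin n → ℂ) → ℂ}
    (hf : f ∈ polynomialParameters n) :
    ∃ C : ℝ, 0 ≤ C ∧ ∃ M : ℕ, ∀ x, ‖f x‖ ≤ C * (1 + ‖x‖) ^ M := by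
  induction hf using Algebra.adjoin_induction with
  | mem f hf =>
    obtain ⟨k, rfl⟩ := hf
    refine ⟨1, zero_le_one, 1, fun x => ?_⟩
    have := norm_le_pi_norm x k
    simp only [one_mul, pow_one]
    linarith
  | algebraMap r => exact ⟨‖r‖, norm_nonneg r, 0, fun x => by simp⟩
  | add f g _ _ hf hg =>
    obtain ⟨C, hC, M, h⟩ := hf
    obtain ⟨C', hC', M', h'⟩ := hg
    refine ⟨C + C', by positivity, M + M', fun x => ?_⟩
    have h1 : 1 ≤ 1 + ‖x‖ := by linarith [norm_nonneg x]
    have e1 : (1 + ‖x‖) ^ M ≤ (1 + ‖x‖) ^ (M + M') := pow_le_pow_right₀ h1 (by omega)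
    have e2 : (1 + ‖x‖) ^ M' ≤ (1 + ‖x‖) ^ (M + M') := pow_le_pow_right₀ h1 (by omega)
    calc ‖f x + g x‖ ≤ ‖f x‖ + ‖g x‖ := norm_add_le _ _
      _ ≤ C * (1 + ‖x‖) ^ M + C' * (1 + ‖x‖) ^ M' := add_le_add (h x) (h' x)
      _ ≤ C * (1 + ‖x‖) ^ (M + M') + C' * (1 + ‖x‖) ^ (M + M') := by gcongr
      _ = _ := by ring
  | mul f g _ _ hf hg =>
    obtain ⟨C, hC, M, h⟩ := hf
    obtain ⟨C', hC', M', h'⟩ := hg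
    refine ⟨C * C', by positivity, M + M', fun x => ?_⟩
    calc ‖f x * g x‖ = ‖f x‖ * ‖g x‖ := norm_mul _ _
      _ ≤ (C * (1 + ‖x‖) ^ M) * (C' * (1 + ‖x‖) ^ M') := by
        gcongr
        · exact h x
        · exact h' x
      _ = _ := by ring

/-- An entire function of polynomial growth that depends on the coordinates in `s` only is a
polynomial: interpolation in one coordinate reduces to a smaller set of coordinates. -/
theorem mem_polynomialParameters_of_growth (s : Finset (Fin n)) :
    ∀ {f : (Fin n → ℂ) → ℂ}, Differentiable ℂ f →
      (∃ C : ℝ, 0 ≤ C ∧ ∃ M : ℕ, ∀ x, ‖f x‖ ≤ C * (1 + ‖x‖) ^ M) →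
      (∀ x y, (∀ k ∈ s, x k = y k) → f x = f y) → f ∈ polynomialParameters n := by
  classical
  induction s using Finset.induction_on with
  | empty =>
    intro f _ _ hs
    have : f = algebraMap ℂ _ (f 0) := by
      funext x
      exact hs x 0 (by simp)
    rw [this]
    exact Subalgebra.algebraMap_mem _ _
  | insert i s _ ih =>
    intro f hf ⟨C, hC, M, hM⟩ hs
    have hupd : ∀ x : Fin n → ℂ, ∀ t : ℂ, ‖Function.update x i t‖ ≤ ‖x‖ + ‖t‖ := by
      intro x t
      refine (pi_norm_le_iff_of_nonneg (by positivity)).2 fun k => ?_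
      by_cases hk : k = i
      · subst hk; simp
      · simp only [Function.update_of_ne hk]
        exact (norm_le_pi_norm x k).trans (by linarith [norm_nonneg t])
    have hgrow : ∀ x : Fin n → ℂ, ∀ t : ℂ, ‖f (Function.update x i t)‖ ≤
        C * (1 + ‖x‖) ^ M * (1 + ‖t‖) ^ M := by
      intro x t
      refine (hM _).trans ?_
      rw [mul_assoc, ← mul_pow]
      gcongr
      have := hupd x t
      nlinarith [norm_nonneg x, norm_nonneg t, mul_nonneg (norm_nonneg x) (norm_nonneg t)]
    have hdiff : ∀ t : ℂ, Differentiable ℂ fun x : Fin n → ℂ => Function.update x i t := by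
      intro t
      refine differentiable_pi.2 fun k => ?_
      by_cases hk : k = i
      · subst hk; simp
      · simp only [Function.update_of_ne hk]; fun_prop
    have hdiff' : ∀ x : Fin n → ℂ, Differentiable ℂ fun t : ℂ => Function.update x i t := by
      intro x
      refine differentiable_pi.2 fun k => ?_
      by_cases hk : k = i
      · subst hk; simp
      · simp only [Function.update_of_ne hk]; fun_prop
    have key : f = ∑ j ∈ Finset.range (M + 1), (fun x => f (Function.update x i (j : ℂ))) *
        aeval (fun x : Fin n → ℂ => x i)
          (Lagrange.basis (Finset.range (M + 1)) (fun j : ℕ => (j : ℂ)) j) := by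
      funext x
      have := Differentiable.eq_sum_lagrange_of_growth (g := fun t => f (Function.update x i t))
        (hf.comp (hdiff' x)) (hgrow x) (x i)
      simp only [Function.update_eq_self] at this
      rw [this, Finset.sum_apply]
      refine Finset.sum_congr rfl fun j _ => ?_
      rw [Pi.mul_apply]
      congr 1
      simp [Polynomial.aeval_def, Polynomial.eval₂_eq_eval_map]
    rw [key]
    refine Subalgebra.sum_mem _ fun j _ => Subalgebra.mul_mem _ (ih ?_ ?_ ?_) ?_
    · exact hf.comp (hdiff j)
    · refine ⟨C * (1 + ‖(j : ℂ)‖) ^ M, by positivity, M, fun x => (hgrow x j).trans (le_of_eq ?_)⟩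
      ring
    · intro x y hxy
      refine hs _ _ fun k hk => ?_
      by_cases hki : k = i
      · subst hki; simp
      · simp only [Function.update_of_ne hki]
        exact hxy k ((Finset.mem_insert.1 hk).resolve_left hki)
    · exact Algebra.adjoin_mono (Set.singleton_subset_iff.2
          (Set.mem_range_self (f := fun (k : Fin n) (x : Fin n → ℂ) => x k) i))
        (aeval_mem_adjoin_singleton ℂ fun x : Fin n → ℂ => x i)

variable {a : Subalgebra ℂ ((Fin n → ℂ) → ℂ)}

@[simp] theorem evalParam_apply (x : Fin n → ℂ) (f : a) : evalParam a x f = (f : (Fin n → ℂ) → ℂ) x :=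
  rfl

theorem eval_map_evalParam_eq (p : a[X]) (f : (Fin n → ℂ) → ℂ) (x : Fin n → ℂ) :
    (p.map (evalParam a x)).eval (f x) = aeval f p x := by
  rw [eval_map]
  exact (hom_eval₂ p (algebraMap a _) (Pi.evalRingHom (fun _ : Fin n → ℂ => ℂ) x) f).symm

/-- In a ring of parameters, every entire function integral over it is a quotient of elements. For
the polynomial ring: an integral function has polynomial growth, so it is a polynomial. -/
theorem IsRingOfParameters.exists_mul_eq (ha : IsRingOfParameters a) {f : (Fin n → ℂ) → ℂ}
    (hf : Differentiable ℂ f) (hi : IsIntegral a f) : ∃ c ∈ a, ∃ d ∈ a, d ≠ 0 ∧ d * f = c := by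
  rcases ha.closed with rfl | h
  · refine ⟨f, ?_, 1, one_mem _, one_ne_zero, one_mul f⟩
    refine mem_polynomialParameters_of_growth Finset.univ hf ?_
      (fun x y h => congrArg f (funext fun k => h k (Finset.mem_univ k)))
    obtain ⟨p, hp, hpf⟩ := hi
    have hb : ∀ x, ‖f x‖ ≤ 1 + ∑ k ∈ Finset.range p.natDegree,
        ‖(p.coeff k : (Fin n → ℂ) → ℂ) x‖ := by
      intro x
      have := (hp.map (evalParam _ x)).norm_root_le (z := f x) (by
        rw [eval_map_evalParam_eq, aeval_def, hpf]; rfl)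
      rw [hp.natDegree_map] at this
      simpa using this
    have hs : ∀ s : Finset ℕ, ∃ C : ℝ, 0 ≤ C ∧ ∃ M : ℕ, ∀ x : Fin n → ℂ,
        1 + ∑ k ∈ s, ‖(p.coeff k : (Fin n → ℂ) → ℂ) x‖ ≤ C * (1 + ‖x‖) ^ M := by
      intro s
      induction s using Finset.induction_on with
      | empty => exact ⟨1, zero_le_one, 0, fun x => by simp⟩
      | insert k s hk ih =>
        obtain ⟨C, hC, M, h⟩ := ih
        obtain ⟨C', hC', M', h'⟩ := exists_growth_of_mem_polynomialParameters (p.coeff k).2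
        refine ⟨C + C', by positivity, M + M', fun x => ?_⟩
        have h1 : 1 ≤ 1 + ‖x‖ := by linarith [norm_nonneg x]
        have e1 : (1 + ‖x‖) ^ M ≤ (1 + ‖x‖) ^ (M + M') := pow_le_pow_right₀ h1 (by omega)
        have e2 : (1 + ‖x‖) ^ M' ≤ (1 + ‖x‖) ^ (M + M') := pow_le_pow_right₀ h1 (by omega)
        rw [Finset.sum_insert hk]
        have g1 := (h x).trans (mul_le_mul_of_nonneg_left e1 hC)
        have g2 := (h' x).trans (mul_le_mul_of_nonneg_left e2 hC')
        linarith
    obtain ⟨C, hC, M, h⟩ := hs (Finset.range p.natDegree)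
    exact ⟨C, hC, M, fun x => (hb x).trans (h x)⟩
  · exact h f hf hi

end PolynomialParameters

/-! ### Analytic continuation along paths -/

section Continuation

variable {n : ℕ} {x y z : Fin n → ℂ}

/-- Permanence of functional relations: an analytic continuation vanishes at one end if and only if
it vanishes at the other. -/
theorem IsAnalyticContinuation.eventuallyEq_zero_iff {γ : Path x y}
    {F : unitInterval → (Fin n → ℂ) → ℂ} (hF : IsAnalyticContinuation γ F) :
    F 0 =ᶠ[𝓝 x] 0 ↔ F 1 =ᶠ[𝓝 y] 0 := by
  have hlc : IsLocallyConstant fun t => F t =ᶠ[𝓝 (γ t)] 0 := by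
    refine (IsLocallyConstant.iff_eventually_eq _).2 fun t => ?_
    obtain ⟨r, hr, hB⟩ := Metric.eventually_nhds_iff_ball.1 (hF.1 t)
    filter_upwards [hF.2 t,
      γ.continuous.continuousAt.preimage_mem_nhds (Metric.ball_mem_nhds (γ t) hr)] with s hs hsB
    refine propext ⟨fun h => ?_, fun h => ?_⟩
    · exact Filter.mem_of_superset (Metric.ball_mem_nhds _ hr) fun w hw =>
        eq_zero_of_eventuallyEq_zero_of_ball hB hsB (hs.symm.trans h) hw
    · have h0 : ∀ w ∈ Metric.ball (γ t) r, F t w = 0 := fun w hw =>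
        eq_zero_of_eventuallyEq_zero_of_ball hB (Metric.mem_ball_self hr) h hw
      exact hs.trans (Filter.mem_of_superset (Metric.isOpen_ball.mem_nhds hsB) h0)
  have := hlc.apply_eq_of_preconnectedSpace 0 1
  simpa using Iff.of_eq this

/-- Holomorphic operations preserve analytic continuation. -/
theorem IsAnalyticContinuation.map {ι : Type*} [Finite ι] {γ : Path x y}
    {F : ι → unitInterval → (Fin n → ℂ) → ℂ} (hF : ∀ k, IsAnalyticContinuation γ (F k))
    (θ : (Fin n → ℂ) → (ι → ℂ) → ℂ)
    (hθ : ∀ (G : ι → (Fin n → ℂ) → ℂ) (w : Fin n → ℂ), (∀ k, DifferentiableAt ℂ (G k) w) →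
      DifferentiableAt ℂ (fun u => θ u fun k => G k u) w) :
    IsAnalyticContinuation γ fun t u => θ u fun k => F k t u := by
  refine ⟨fun t => ?_, fun t => ?_⟩
  · filter_upwards [eventually_all.2 fun k => (hF k).1 t] with w hw
    exact hθ (fun k => F k t) w hw
  · filter_upwards [eventually_all.2 fun k => (hF k).2 t] with s hs
    filter_upwards [eventually_all.2 hs] with w hw
    simp only [hw]

/-- Continuation along `γ`, followed by a path along which the final function element stays
holomorphic. -/
theorem IsAnalyticContinuation.trans_const {γ : Path x y} (δ : Path y z)
    {F : unitInterval → (Fin n → ℂ) → ℂ} (hF : IsAnalyticContinuation γ F)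
    {Φ : (Fin n → ℂ) → ℂ} (hΦ : ∀ t, ∀ᶠ w in 𝓝 (δ t), DifferentiableAt ℂ Φ w)
    (h : F 1 =ᶠ[𝓝 y] Φ) :
    ∃ F', IsAnalyticContinuation (γ.trans δ) F' ∧ F' 0 = F 0 ∧ F' 1 = Φ := by
  classical
  set p : unitInterval → unitInterval := fun t => Set.projIcc 0 1 zero_le_one (2 * (t : ℝ)) with hp
  set q : unitInterval → unitInterval :=
    fun t => Set.projIcc 0 1 zero_le_one (2 * (t : ℝ) - 1) with hq
  have hpc : Continuous p := continuous_projIcc.comp (by fun_prop)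
  have hle : ∀ t : unitInterval, (t : ℝ) ≤ 1 / 2 → (γ.trans δ) t = γ (p t) := by
    intro t ht
    rw [Path.trans_apply, dif_pos ht]
    congr 1
    refine (Set.projIcc_of_mem zero_le_one (x := 2 * (t : ℝ)) ?_).symm
  have hgt : ∀ t : unitInterval, ¬ (t : ℝ) ≤ 1 / 2 → (γ.trans δ) t = δ (q t) := by
    intro t ht
    rw [Path.trans_apply, dif_neg ht]
    congr 1
    refine (Set.projIcc_of_mem zero_le_one (x := 2 * (t : ℝ) - 1) ?_).symm
  have hc : Continuous (γ.trans δ) := (γ.trans δ).continuous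
  refine ⟨fun t => if (t : ℝ) ≤ 1 / 2 then F (p t) else Φ, ⟨fun t => ?_, fun t => ?_⟩, ?_, ?_⟩
  · by_cases ht : (t : ℝ) ≤ 1 / 2
    · simp only [ht, if_true, hle t ht]
      exact hF.1 _
    · simp only [ht, if_false, hgt t ht]
      exact hΦ _
  · rcases lt_trichotomy (t : ℝ) (1 / 2) with ht | ht | ht
    · have hev : ∀ᶠ s : unitInterval in 𝓝 t, (s : ℝ) < 1 / 2 :=
        continuous_subtype_val.continuousAt.eventually_lt continuousAt_const ht
      filter_upwards [hev, hpc.continuousAt.eventually (hF.2 (p t))] with s hs hs'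
      rw [if_pos hs.le, if_pos ht.le, hle s hs.le]
      exact hs'
    · have hp1 : p t = 1 := by
        simp only [hp, ht]
        norm_num
      have hy : (γ.trans δ) t = y := by rw [hle t ht.le, hp1, γ.target]
      have h2 := hpc.continuousAt.eventually (hF.2 (p t))
      have h3 : ∀ᶠ s in 𝓝 t, F 1 =ᶠ[𝓝 ((γ.trans δ) s)] Φ := by
        have : ∀ᶠ w in 𝓝 ((γ.trans δ) t), F 1 =ᶠ[𝓝 w] Φ := by
          rw [hy]; exact eventually_eventually_nhds.2 h
        exact hc.continuousAt.eventually this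
      filter_upwards [h2, h3] with s hs hs'
      rw [if_pos ht.le, hp1]
      by_cases hs2 : (s : ℝ) ≤ 1 / 2
      · rw [if_pos hs2, hle s hs2]
        rw [hp1] at hs
        exact hs
      · rw [if_neg hs2]
        exact hs'.symm
    · have hev : ∀ᶠ s : unitInterval in 𝓝 t, 1 / 2 < (s : ℝ) :=
        continuousAt_const.eventually_lt continuous_subtype_val.continuousAt ht
      filter_upwards [hev] with s hs
      rw [if_neg (not_le.2 hs), if_neg (not_le.2 ht)]
  · have hp0 : p 0 = 0 := by
      simp [hp]
    simp [hp0]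
  · norm_num

end Continuation

/-! ### Continuation of the expectation values along paths in theory space -/

namespace ChiralSector

variable {n m : ℕ} {Vac : Type*} (T : ChiralSector n m Vac)

/-- There is a path in theory space from the base point to `x` along which each expectation value
`T.vev s i` is analytically continued to the function element `Φ s i` at `x`. -/
def Continues (x : Fin n → ℂ) (Φ : Fin m → Vac → (Fin n → ℂ) → ℂ) : Prop :=
  ∃ γ : Path T.base x, (∀ t, γ t ∈ T.theorySpace) ∧
    ∀ i s, ∃ F : unitInterval → (Fin n → ℂ) → ℂ, IsAnalyticContinuation γ F ∧
      F 0 =ᶠ[𝓝 T.base] T.vev s i ∧ F 1 =ᶠ[𝓝 x] Φ s i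

variable {T} {x y : Fin n → ℂ} {Φ Ψ : Fin m → Vac → (Fin n → ℂ) → ℂ}

theorem continues_base : T.Continues T.base T.vev := by
  refine ⟨Path.refl _, fun t => T.base_mem, fun i s => ⟨fun _ => T.vev s i, ⟨fun t => ?_, fun t => ?_⟩,
    EventuallyEq.rfl, EventuallyEq.rfl⟩⟩
  · simpa using T.holomorphic s i
  · exact Eventually.of_forall fun _ => EventuallyEq.rfl

theorem Continues.trans (h : T.Continues x Φ) (δ : Path x y) (hδ : ∀ t, δ t ∈ T.theorySpace)
    (hΨ : ∀ s i t, ∀ᶠ w in 𝓝 (δ t), DifferentiableAt ℂ (Ψ s i) w)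
    (hΦΨ : ∀ s i, Φ s i =ᶠ[𝓝 x] Ψ s i) : T.Continues y Ψ := by
  obtain ⟨γ, hγ, hF⟩ := h
  refine ⟨γ.trans δ, fun t => ?_, fun i s => ?_⟩
  · have : (γ.trans δ) t ∈ Set.range γ ∪ Set.range δ := by
      rw [← Path.trans_range]; exact Set.mem_range_self t
    rcases this with ⟨u, hu⟩ | ⟨u, hu⟩
    · exact hu ▸ hγ u
    · exact hu ▸ hδ u
  · obtain ⟨F, hF, h0, h1⟩ := hF i s
    obtain ⟨F', hF', h0', h1'⟩ := hF.trans_const δ (hΨ s i) (h1.trans (hΦΨ s i))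
    exact ⟨F', hF', h0' ▸ h0, h1' ▸ EventuallyEq.rfl⟩

theorem Continues.differentiableAt (h : T.Continues x Φ) (s : Fin m) (i : Vac) :
    ∀ᶠ w in 𝓝 x, DifferentiableAt ℂ (Φ s i) w := by
  obtain ⟨γ, hγ, hF⟩ := h
  obtain ⟨F, hF, h0, h1⟩ := hF i s
  have := hF.1 1
  rw [γ.target] at this
  filter_upwards [this, eventually_eventually_nhds.2 h1] with w hw hw'
  exact hw.congr_of_eventuallyEq (EventuallyEq.symm hw')

/-- Holomorphic relations between the expectation values hold before analytic continuation if and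
only if they hold afterwards. -/
theorem Continues.relation_iff [Finite Vac] (h : T.Continues x Φ)
    (θ : (Fin n → ℂ) → (Fin m → Vac → ℂ) → ℂ)
    (hθ : ∀ (G : Fin m → Vac → (Fin n → ℂ) → ℂ) (w : Fin n → ℂ),
      (∀ s i, DifferentiableAt ℂ (G s i) w) → DifferentiableAt ℂ (fun u => θ u fun s i => G s i u) w) :
    (∀ᶠ w in 𝓝 T.base, θ w (fun s i => T.vev s i w) = 0) ↔
      ∀ᶠ w in 𝓝 x, θ w (fun s i => Φ s i w) = 0 := by
  obtain ⟨γ, hγ, hF⟩ := h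
  choose F hF h0 h1 using hF
  have key := (IsAnalyticContinuation.map (ι := Fin m × Vac) (F := fun k => F k.2 k.1)
    (fun k => hF k.2 k.1) (fun u c => θ u fun s i => c (s, i))
    (fun G w hG => hθ (fun s i => G (s, i)) w fun s i => hG (s, i))).eventuallyEq_zero_iff
  have e0 : ∀ᶠ w in 𝓝 T.base, ∀ i s, F i s 0 w = T.vev s i w :=
    eventually_all.2 fun i => eventually_all.2 fun s => h0 i s
  have e1 : ∀ᶠ w in 𝓝 x, ∀ i s, F i s 1 w = Φ s i w :=
    eventually_all.2 fun i => eventually_all.2 fun s => h1 i s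
  have k0 : (∀ᶠ w in 𝓝 T.base, θ w (fun s i => T.vev s i w) = 0) ↔
      (fun u => θ u fun s i => F i s 0 u) =ᶠ[𝓝 T.base] 0 :=
    eventually_congr (e0.mono fun w hw => by simp [hw])
  have k1 : (∀ᶠ w in 𝓝 x, θ w (fun s i => Φ s i w) = 0) ↔
      (fun u => θ u fun s i => F i s 1 u) =ᶠ[𝓝 x] 0 :=
    eventually_congr (e1.mono fun w hw => by simp [hw])
  rw [k0, k1]
  exact key

end ChiralSector

/-! ### Holomorphic dependence of simple roots on parameters -/

section LocalRoots

variable {E : Type*} [NormedAddCommGroup E] [NormedSpace ℂ E]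

/-- The product of a function differentiable and vanishing at a point with a function merely
continuous there is differentiable at that point. -/
theorem DifferentiableAt.mul_continuousAt_of_eq_zero {g k : E → ℂ} {x : E}
    (hg : DifferentiableAt ℂ g x) (hg0 : g x = 0) (hk : ContinuousAt k x) :
    DifferentiableAt ℂ (fun y => g y * k y) x := by
  obtain ⟨g', hg'⟩ := hg
  refine ⟨k x • g', ?_⟩
  rw [hasFDerivAt_iff_isLittleO] at hg' ⊢
  have hkO : k =O[𝓝 x] fun _ => (1 : ℝ) := hk.isBigO_one ℝ
  have hko : (fun y => k y - k x) =o[𝓝 x] fun _ => (1 : ℝ) := by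
    rw [Asymptotics.isLittleO_one_iff]
    simpa using hk.sub_const (k x)
  have h1 : (fun y => k y * (g y - g x - g' (y - x))) =o[𝓝 x] fun y => y - x := by
    have := hkO.mul_isLittleO hg'.norm_right
    simpa using this
  have h2 : (fun y => (k y - k x) * g' (y - x)) =o[𝓝 x] fun y => y - x := by
    have hO : (fun y => g' (y - x)) =O[𝓝 x] fun y => ‖y - x‖ :=
      (g'.isBigO_comp (fun y => y - x) (𝓝 x)).norm_right
    have := hko.mul_isBigO hO
    simpa using this
  refine (h1.add h2).congr_left fun y => ?_
  simp only [hg0, FunLike.coe_smul, Pi.smul_apply, smul_eq_mul]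
  ring

variable {ι : Type*} [Fintype ι]

theorem eval_C_mul_prod_X_sub_C (b : ℂ) (ρ : ι → ℂ) (y : ℂ) :
    (C b * ∏ i, (X - C (ρ i))).eval y = b * ∏ i, (y - ρ i) := by
  simp [eval_prod]

/-- Near a root of a member of a continuous family of split polynomials of constant degree, nearby
members have roots. -/
theorem eventually_exists_root_near {Y : Type*} [TopologicalSpace Y] {p : Y → ℂ[X]} {c : Y → ℂ}
    (hp : ∀ y, Continuous fun x => (p x).eval y)
    (hc : Continuous c) {x₀ : Y} (hcx : c x₀ ≠ 0)
    (hP : ∀ᶠ x in 𝓝 x₀, ∃ ρ : ι → ℂ, p x = C (c x) * ∏ i, (X - C (ρ i)))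
    {y₀ : ℂ} (hy₀ : (p x₀).eval y₀ = 0) {ε : ℝ} (hε : 0 < ε) :
    ∀ᶠ x in 𝓝 x₀, ∃ y, dist y y₀ < ε ∧ (p x).eval y = 0 := by
  have h1 : ∀ᶠ x in 𝓝 x₀, ‖(p x).eval y₀‖ < ‖c x‖ * ε ^ Fintype.card ι := by
    refine ((hp y₀).norm.continuousAt).eventually_lt
      ((hc.norm.mul continuous_const).continuousAt) ?_
    rw [hy₀, norm_zero]
    have := norm_pos_iff.2 hcx
    positivity
  filter_upwards [h1, hP] with x hx hPx
  obtain ⟨ρ, hρ⟩ := hPx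
  by_contra! hne
  have hroot : ∀ i, (p x).eval (ρ i) = 0 := fun i => by
    rw [hρ, eval_C_mul_prod_X_sub_C, Finset.prod_eq_zero (Finset.mem_univ i) (sub_self _), mul_zero]
  have hfar : ∀ i, ε ≤ ‖y₀ - ρ i‖ := fun i => by
    by_contra! h
    exact hne (ρ i) (by rwa [dist_comm, dist_eq_norm]) (hroot i)
  refine absurd hx (not_lt.2 ?_)
  rw [hρ, eval_C_mul_prod_X_sub_C, norm_mul, norm_prod]
  gcongr
  calc ε ^ Fintype.card ι = ∏ _i : ι, ε := by simp
    _ ≤ ∏ i, ‖y₀ - ρ i‖ := Finset.prod_le_prod (fun _ _ => hε.le) fun i _ => hfar i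

/-- The roots of a holomorphic family of separable polynomials of constant degree are, locally,
values of holomorphic functions of the parameters. -/
theorem exists_local_roots {p : E → ℂ[X]} {c : E → ℂ}
    (hp : ∀ y, Differentiable ℂ fun x => (p x).eval y)
    (hc : Continuous c) {U : Set E} (hU : IsOpen U) (hcU : ∀ x ∈ U, c x ≠ 0)
    (hP : ∀ x ∈ U, ∃ ρ : ι → ℂ, Function.Injective ρ ∧ p x = C (c x) * ∏ i, (X - C (ρ i)))
    {x₀ : E} (hx₀ : x₀ ∈ U) :
    ∃ r > 0, Metric.ball x₀ r ⊆ U ∧ ∃ φ : ι → E → ℂ,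
      (∀ i, ∀ x ∈ Metric.ball x₀ r, DifferentiableAt ℂ (φ i) x) ∧
      ∀ x ∈ Metric.ball x₀ r, Function.Injective (fun i => φ i x) ∧
        p x = C (c x) * ∏ i, (X - C (φ i x)) := by
  classical
  have hpc : ∀ y, Continuous fun x => (p x).eval y := fun y => (hp y).continuous
  have hnear : ∀ x₁ ∈ U, ∀ y₀, (p x₁).eval y₀ = 0 → ∀ ε > 0,
      ∀ᶠ x in 𝓝 x₁, ∃ y, dist y y₀ < ε ∧ (p x).eval y = 0 := fun x₁ hx₁ y₀ hy₀ ε hε =>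
    eventually_exists_root_near hpc hc (hcU x₁ hx₁)
      (Filter.mem_of_superset (hU.mem_nhds hx₁) fun x hx => (hP x hx).imp fun _ h => h.2) hy₀ hε
  obtain ⟨ρ, hρ, hpρ⟩ := hP x₀ hx₀
  -- radii of pairwise disjoint discs about the roots at `x₀`
  obtain ⟨ε, hε, hdisj⟩ : ∃ ε > 0, ∀ i j, i ≠ j → 2 * ε < dist (ρ i) (ρ j) := by
    have h : ∀ᶠ ε : ℝ in 𝓝[>] 0, ∀ i j, i ≠ j → 2 * ε < dist (ρ i) (ρ j) := by
      refine eventually_all.2 fun i => eventually_all.2 fun j => ?_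
      by_cases hij : i = j
      · exact Eventually.of_forall fun _ h => absurd hij h
      · have : Tendsto (fun ε : ℝ => 2 * ε) (𝓝[>] 0) (𝓝 0) := by
          have : Tendsto (fun ε : ℝ => 2 * ε) (𝓝 0) (𝓝 0) :=
            Continuous.tendsto' (by fun_prop) 0 0 (by simp)
          exact this.mono_left nhdsWithin_le_nhds
        filter_upwards [this.eventually_lt_const (dist_pos.2 fun h => hij (hρ h))] with ε hε _
        exact hε
    obtain ⟨ε, h1, h2⟩ := (h.and self_mem_nhdsWithin).exists
    exact ⟨ε, h2, h1⟩
  have hroots : ∀ i, (p x₀).eval (ρ i) = 0 := fun i => by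
    rw [hpρ, eval_C_mul_prod_X_sub_C, Finset.prod_eq_zero (Finset.mem_univ i) (sub_self _),
      mul_zero]
  obtain ⟨r, hr, hball⟩ := Metric.eventually_nhds_iff_ball.1
    ((show ∀ᶠ x in 𝓝 x₀, x ∈ U from hU.mem_nhds hx₀).and
      (eventually_all.2 fun i => hnear x₀ hx₀ (ρ i) (hroots i) ε hε))
  set φ : ι → E → ℂ := fun i x =>
    if h : ∃ y, dist y (ρ i) < ε ∧ (p x).eval y = 0 then h.choose else 0 with hφ
  have hφs : ∀ i, ∀ x ∈ Metric.ball x₀ r, dist (φ i x) (ρ i) < ε ∧ (p x).eval (φ i x) = 0 := by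
    intro i x hx
    have h := (hball x hx).2 i
    simp only [hφ, dif_pos h]
    exact h.choose_spec
  have huniq : ∀ i j y, dist y (ρ i) < ε → dist y (ρ j) < ε → i = j := by
    intro i j y hi hj
    by_contra hij
    have := dist_triangle_left (ρ i) (ρ j) y
    linarith [hdisj i j hij]
  have hinj : ∀ x ∈ Metric.ball x₀ r, Function.Injective fun i => φ i x := by
    intro x hx i j hij
    refine huniq i j (φ i x) (hφs i x hx).1 ?_
    rw [show φ i x = φ j x from hij]
    exact (hφs j x hx).1
  have hprod : ∀ x ∈ Metric.ball x₀ r, p x = C (c x) * ∏ i, (X - C (φ i x)) := by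
    intro x hx
    obtain ⟨σ, hσ, hpσ⟩ := hP x (hball x hx).1
    have hex : ∀ i, ∃ j, φ i x = σ j := by
      intro i
      have h := (hφs i x hx).2
      rw [hpσ, eval_C_mul_prod_X_sub_C] at h
      obtain ⟨j, -, hj⟩ := Finset.prod_eq_zero_iff.1
        ((mul_eq_zero.1 h).resolve_left (hcU x (hball x hx).1))
      exact ⟨j, sub_eq_zero.1 hj⟩
    choose τ hτ using hex
    have hτi : Function.Injective τ := fun i j hij => hinj x hx (by simp [hτ, hij])
    have hτb : Function.Bijective τ := Finite.injective_iff_bijective.1 hτi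
    rw [hpσ]
    congr 1
    exact (Fintype.prod_bijective τ hτb _ _ fun i => by rw [hτ]).symm
  have hcont : ∀ i, ∀ x ∈ Metric.ball x₀ r, ContinuousAt (φ i) x := by
    intro i x₁ hx₁
    rw [Metric.continuousAt_iff']
    intro ε' hε'
    have h0 : 0 < min ε' (ε - dist (φ i x₁) (ρ i)) :=
      lt_min hε' (sub_pos.2 (hφs i x₁ hx₁).1)
    filter_upwards [hnear x₁ (hball x₁ hx₁).1 _ (hφs i x₁ hx₁).2 _ h0,
      Metric.isOpen_ball.mem_nhds hx₁] with x hx hxB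
    obtain ⟨y, hy, hy0⟩ := hx
    rw [hprod x hxB, eval_C_mul_prod_X_sub_C] at hy0
    obtain ⟨j, -, hj⟩ := Finset.prod_eq_zero_iff.1
      ((mul_eq_zero.1 hy0).resolve_left (hcU x (hball x hxB).1))
    have hyj : y = φ j x := sub_eq_zero.1 hj
    have hyi : dist y (ρ i) < ε := by
      have h1 := dist_triangle y (φ i x₁) (ρ i)
      have h2 := hy.trans_le (min_le_right _ _)
      linarith
    have : i = j := huniq i j y hyi (hyj ▸ (hφs j x hxB).1)
    subst this
    rw [← hyj]
    exact hy.trans_le (min_le_left _ _)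
  refine ⟨r, hr, fun x hx => (hball x hx).1, φ, fun i x₁ hx₁ => ?_, fun x hx =>
    ⟨hinj x hx, hprod x hx⟩⟩
  -- the factorization at `x`, evaluated at `φ i x₁`, gives `φ i x` up to a continuous factor
  set h : E → ℂ := fun x => c x * ∏ j ∈ Finset.univ.erase i, (φ i x₁ - φ j x) with hh
  have hhc : ContinuousAt h x₁ := by
    refine hc.continuousAt.mul (tendsto_finsetProd _ fun j _ => ?_)
    exact continuousAt_const.sub (hcont j x₁ hx₁)
  have hh0 : h x₁ ≠ 0 := by
    refine mul_ne_zero (hcU x₁ (hball x₁ hx₁).1) (Finset.prod_ne_zero_iff.2 fun j hj => ?_)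
    refine sub_ne_zero.2 fun e => (Finset.ne_of_mem_erase hj) ?_
    exact (hinj x₁ hx₁ e).symm
  have hd := (hp (φ i x₁) x₁).mul_continuousAt_of_eq_zero (hφs i x₁ hx₁).2 (hhc.inv₀ hh0)
  refine (hd.const_sub (φ i x₁)).congr_of_eventuallyEq ?_
  filter_upwards [Metric.isOpen_ball.mem_nhds hx₁, hhc.eventually_ne hh0] with x hx hhx
  have hev : (p x).eval (φ i x₁) = (φ i x₁ - φ i x) * h x := by
    rw [hprod x hx, eval_C_mul_prod_X_sub_C, ← Finset.mul_prod_erase _ _ (Finset.mem_univ i)]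
    simp only [hh]
    ring
  rw [hev, mul_assoc, Pi.inv_apply, mul_inv_cancel₀ hhx]
  ring

/-- Enumeration of the roots of a separable complex polynomial. -/
theorem Polynomial.Separable.exists_injective_roots {p : ℂ[X]} (hp : p.Separable)
    (hdeg : p.natDegree = Fintype.card ι) :
    ∃ ρ : ι → ℂ, Function.Injective ρ ∧ p = C p.leadingCoeff * ∏ i, (X - C (ρ i)) := by
  classical
  have hs : p.Splits := IsAlgClosed.splits p
  have hnd : p.roots.Nodup := nodup_roots hp
  have hcard : Fintype.card ι = Fintype.card p.roots.toFinset := by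
    rw [Fintype.card_coe, Multiset.toFinset_card_of_nodup hnd, ← hdeg, hs.natDegree_eq_card_roots]
  set e : ι ≃ p.roots.toFinset := Fintype.equivOfCardEq hcard
  refine ⟨fun i => e i, Subtype.val_injective.comp e.injective, ?_⟩
  conv_lhs => rw [hs.eq_prod_roots]
  congr 1
  rw [Fintype.prod_equiv e (fun i => X - C (e i : ℂ)) (fun y => X - C (y : ℂ)) fun _ => rfl,
    Finset.prod_coe_sort p.roots.toFinset (fun y => X - C y), Finset.prod_multiset_map_count]
  refine Finset.prod_congr rfl fun y hy => ?_
  rw [Multiset.count_eq_one_of_mem hnd (Multiset.mem_toFinset.1 hy), pow_one]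

end LocalRoots

/-! ### Sheets of the spectral variety -/

theorem differentiableAt_eval₂_evalParam {n : ℕ} {a : Subalgebra ℂ ((Fin n → ℂ) → ℂ)}
    (ha : ∀ f ∈ a, Differentiable ℂ f) {ι : Type*} (ρ : MvPolynomial ι a)
    {G : ι → (Fin n → ℂ) → ℂ} {w : Fin n → ℂ} (hG : ∀ s, DifferentiableAt ℂ (G s) w) :
    DifferentiableAt ℂ (fun u => MvPolynomial.eval₂ (evalParam a u) (fun s => G s u) ρ) w := by
  induction ρ using MvPolynomial.induction_on with
  | C f =>
    simp only [MvPolynomial.eval₂_C, evalParam_apply]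
    exact ha f f.2 w
  | add p q hp hq =>
    simp only [MvPolynomial.eval₂_add]
    exact hp.add hq
  | mul_X p s hp =>
    simp only [MvPolynomial.eval₂_mul, MvPolynomial.eval₂_X]
    exact hp.mul (hG s)

theorem differentiableAt_eval_map_evalParam {n : ℕ} {a : Subalgebra ℂ ((Fin n → ℂ) → ℂ)}
    (ha : ∀ f ∈ a, Differentiable ℂ f) (Q : a[X])
    {g : (Fin n → ℂ) → ℂ} {w : Fin n → ℂ} (hg : DifferentiableAt ℂ g w) :
    DifferentiableAt ℂ (fun u => (Q.map (evalParam a u)).eval (g u)) w := by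
  induction Q using Polynomial.induction_on' with
  | add p q hp hq =>
    simp only [Polynomial.map_add, eval_add]
    exact hp.add hq
  | monomial k f =>
    simp only [map_monomial, eval_monomial, evalParam_apply]
    exact (ha f f.2 w).mul (hg.pow k)

/-- A product over the roots of a split polynomial, in terms of an enumeration of the roots. -/
theorem prod_map_roots_C_mul_prod {ι : Type*} [Fintype ι] {b : ℂ} (hb : b ≠ 0) (ρ : ι → ℂ)
    (f : ℂ → ℂ) : ((C b * ∏ i, (X - C (ρ i))).roots.map f).prod = ∏ i, f (ρ i) := by
  rw [roots_C_mul _ hb, roots_prod _ _ (Finset.prod_ne_zero_iff.2 fun i _ => X_sub_C_ne_zero _)]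
  simp

namespace ChiralSector

variable {n m : ℕ} {Vac : Type*} (T : ChiralSector n m Vac) (a : Subalgebra ℂ ((Fin n → ℂ) → ℂ))

/-- The value of the chiral operator `ρ` when the generators take the values `Φ s`. -/
def operatorValue (ρ : MvPolynomial (Fin m) a) (Φ : Fin m → (Fin n → ℂ) → ℂ) (x : Fin n → ℂ) : ℂ :=
  MvPolynomial.eval₂ (evalParam a x) (fun s => Φ s x) ρ

/-- An entire function `D` off whose zeros the theory is regular with respect to the operator `O`
and its polynomial `P`: the parameters belong to the theory space, `P` keeps its degree and has
simple roots, and the expectation values of the generators are determined by that of `O`, which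
distinguishes the vacua, through
the relations `d s * 𝒪ₛ = Q s (O)`, with `d s` nonzero. -/
structure RegularLocus (O : MvPolynomial (Fin m) a) (P : a[X]) where
  entire : ∀ f ∈ a, Differentiable ℂ f
  D : (Fin n → ℂ) → ℂ
  differentiable : Differentiable ℂ D
  ne_zero : D ≠ 0
  mem_theorySpace : ∀ x, D x ≠ 0 → x ∈ T.theorySpace
  leadingCoeff_ne_zero : ∀ x, D x ≠ 0 → evalParam a x P.leadingCoeff ≠ 0
  separable : ∀ x, D x ≠ 0 → (P.map (evalParam a x)).Separable
  root : ∀ i, ∀ᶠ x in 𝓝 T.base, (P.map (evalParam a x)).eval (T.expectation a O i x) = 0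
  injective : ∀ i j, T.expectation a O i =ᶠ[𝓝 T.base] T.expectation a O j → i = j
  d : Fin m → a
  d_ne_zero : ∀ s x, D x ≠ 0 → evalParam a x (d s) ≠ 0
  Q : Fin m → a[X]
  rel : ∀ s i, ∀ᶠ x in 𝓝 T.base, evalParam a x (d s) * T.vev s i x =
    ((Q s).map (evalParam a x)).eval (T.expectation a O i x)

variable {T a} {O : MvPolynomial (Fin m) a} {P : a[X]}

theorem operatorValue_congr {Φ Ψ : Fin m → (Fin n → ℂ) → ℂ} {x : Fin n → ℂ}
    (h : ∀ s, Φ s =ᶠ[𝓝 x] Ψ s) : operatorValue a O Φ =ᶠ[𝓝 x] operatorValue a O Ψ := by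
  filter_upwards [eventually_all.2 h] with w hw
  simp only [operatorValue, hw]

namespace RegularLocus

section

variable (R : T.RegularLocus a O P)
include R

theorem differentiableAt_operatorValue {Φ : Fin m → (Fin n → ℂ) → ℂ} {w : Fin n → ℂ}
    (h : ∀ s, DifferentiableAt ℂ (Φ s) w) : DifferentiableAt ℂ (operatorValue a O Φ) w :=
  differentiableAt_eval₂_evalParam R.entire O h

theorem differentiableAt_eval {g : (Fin n → ℂ) → ℂ} {w : Fin n → ℂ} (q : a[X])
    (hg : DifferentiableAt ℂ g w) :
    DifferentiableAt ℂ (fun u => (q.map (evalParam a u)).eval (g u)) w :=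
  differentiableAt_eval_map_evalParam R.entire q hg

theorem isOpen : IsOpen {x | R.D x ≠ 0} :=
  isOpen_ne_fun R.differentiable.continuous continuous_const

variable {x : Fin n → ℂ} {Φ : Fin m → Vac → (Fin n → ℂ) → ℂ}

theorem differentiableAt_continues (h : T.Continues x Φ) (i : Vac) :
    ∀ᶠ w in 𝓝 x, DifferentiableAt ℂ (operatorValue a O fun s => Φ s i) w := by
  filter_upwards [eventually_all.2 fun s => h.differentiableAt s i] with w hw
  exact R.differentiableAt_operatorValue hw

variable [Fintype Vac]

theorem root_continues (h : T.Continues x Φ) (i : Vac) :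
    ∀ᶠ w in 𝓝 x, (P.map (evalParam a w)).eval (operatorValue a O (fun s => Φ s i) w) = 0 :=
  (h.relation_iff (fun w c => (P.map (evalParam a w)).eval
      (MvPolynomial.eval₂ (evalParam a w) (fun s => c s i) O))
    fun _ _ hG => R.differentiableAt_eval P
      (differentiableAt_eval₂_evalParam R.entire O fun s => hG s i)).1 (R.root i)

theorem rel_continues (h : T.Continues x Φ) (s : Fin m) (i : Vac) :
    ∀ᶠ w in 𝓝 x, evalParam a w (R.d s) * Φ s i w =
      ((R.Q s).map (evalParam a w)).eval (operatorValue a O (fun s => Φ s i) w) := by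
  have := (h.relation_iff (fun w c => evalParam a w (R.d s) * c s i -
      ((R.Q s).map (evalParam a w)).eval
        (MvPolynomial.eval₂ (evalParam a w) (fun s => c s i) O))
    fun G w hG => ((R.entire _ (R.d s).2 w).mul (hG s i)).sub (R.differentiableAt_eval (R.Q s)
      (differentiableAt_eval₂_evalParam R.entire O fun s => hG s i))).1
    ((R.rel s i).mono fun w hw => sub_eq_zero.2 hw)
  exact this.mono fun w hw => sub_eq_zero.1 hw

theorem operatorValue_injective (h : T.Continues x Φ) {i j : Vac}
    (hij : operatorValue a O (fun s => Φ s i) =ᶠ[𝓝 x] operatorValue a O fun s => Φ s j) :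
    i = j := by
  refine R.injective i j ?_
  have := (h.relation_iff (fun w c =>
      MvPolynomial.eval₂ (evalParam a w) (fun s => c s i) O -
        MvPolynomial.eval₂ (evalParam a w) (fun s => c s j) O)
    fun G w hG => (differentiableAt_eval₂_evalParam R.entire O fun s => hG s i).sub
      (differentiableAt_eval₂_evalParam R.entire O fun s => hG s j)).2
    (hij.mono fun w hw => sub_eq_zero.2 hw)
  exact this.mono fun w hw => sub_eq_zero.1 hw

theorem exists_roots (hdeg : P.degree = (Fintype.card Vac : WithBot ℕ)) {x : Fin n → ℂ}
    (hx : R.D x ≠ 0) : ∃ ρ : Vac → ℂ, Function.Injective ρ ∧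
      P.map (evalParam a x) = C (evalParam a x P.leadingCoeff) * ∏ i, (X - C (ρ i)) := by
  have hl := R.leadingCoeff_ne_zero x hx
  have hd : (P.map (evalParam a x)).natDegree = Fintype.card Vac := by
    rw [natDegree_map_of_leadingCoeff_ne_zero _ hl]
    exact natDegree_eq_of_degree_eq_some hdeg
  obtain ⟨ρ, hρ, h⟩ := (R.separable x hx).exists_injective_roots hd
  rw [leadingCoeff_map_of_leadingCoeff_ne_zero _ hl] at h
  exact ⟨ρ, hρ, h⟩

end

variable [Fintype Vac] {x : Fin n → ℂ} {Φ : Fin m → Vac → (Fin n → ℂ) → ℂ}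

/-- The functions `φ k` enumerate holomorphically the roots of the polynomial of `O` in a ball of
regular parameters. -/
structure IsRootSheets (R : T.RegularLocus a O P) (x₀ : Fin n → ℂ) (r : ℝ)
    (φ : Vac → (Fin n → ℂ) → ℂ) : Prop where
  regular : ∀ x ∈ Metric.ball x₀ r, R.D x ≠ 0
  differentiableAt : ∀ k, ∀ x ∈ Metric.ball x₀ r, DifferentiableAt ℂ (φ k) x
  injective : ∀ x ∈ Metric.ball x₀ r, Function.Injective fun k => φ k x
  eq_prod : ∀ x ∈ Metric.ball x₀ r, P.map (evalParam a x) =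
    C (evalParam a x P.leadingCoeff) * ∏ k, (X - C (φ k x))

theorem exists_isRootSheets (R : T.RegularLocus a O P)
    (hdeg : P.degree = (Fintype.card Vac : WithBot ℕ)) {x₀ : Fin n → ℂ}
    (hx₀ : R.D x₀ ≠ 0) : ∃ r > 0, ∃ φ, R.IsRootSheets x₀ r φ := by
  obtain ⟨r, hr, hU, φ, hφ, h⟩ := exists_local_roots (p := fun x => P.map (evalParam a x))
    (c := fun x => evalParam a x P.leadingCoeff)
    (fun y x => R.differentiableAt_eval P (differentiableAt_const y))
    (R.entire _ P.leadingCoeff.2).continuous R.isOpen (fun x hx => R.leadingCoeff_ne_zero x hx)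
    (fun x hx => R.exists_roots hdeg hx) hx₀
  exact ⟨r, hr, φ, fun x hx => hU hx, hφ, fun x hx => (h x hx).1, fun x hx => (h x hx).2⟩

variable {R : T.RegularLocus a O P} {x₀ y : Fin n → ℂ} {r : ℝ} {φ : Vac → (Fin n → ℂ) → ℂ}

theorem IsRootSheets.exists_eq (hφ : R.IsRootSheets x₀ r φ) (hx : x ∈ Metric.ball x₀ r) {z : ℂ}
    (hz : (P.map (evalParam a x)).eval z = 0) : ∃ k, z = φ k x := by
  rw [hφ.eq_prod x hx, eval_C_mul_prod_X_sub_C] at hz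
  obtain ⟨k, -, hk⟩ := Finset.prod_eq_zero_iff.1
    ((mul_eq_zero.1 hz).resolve_left (R.leadingCoeff_ne_zero x (hφ.regular x hx)))
  exact ⟨k, sub_eq_zero.1 hk⟩

/-- A continuation of the expectation value of `O` to a regular point is one of the local roots. -/
theorem IsRootSheets.exists_eventuallyEq (hφ : R.IsRootSheets x₀ r φ)
    (hx : x ∈ Metric.ball x₀ r) (h : T.Continues x Φ) (i : Vac) :
    ∃ k, operatorValue a O (fun s => Φ s i) =ᶠ[𝓝 x] φ k := by
  obtain ⟨k, hk⟩ := hφ.exists_eq hx (R.root_continues h i).self_of_nhds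
  refine ⟨k, ?_⟩
  have hc := (R.differentiableAt_continues h i).self_of_nhds.continuousAt
  have hne : ∀ᶠ w in 𝓝 x, ∀ l, l ≠ k → operatorValue a O (fun s => Φ s i) w ≠ φ l w := by
    refine eventually_all.2 fun l => ?_
    by_cases hl : l = k
    · exact Eventually.of_forall fun w h => absurd hl h
    · have h1 : operatorValue a O (fun s => Φ s i) x ≠ φ l x := by
        rw [hk]
        exact fun e => hl (hφ.injective x hx e.symm)
      filter_upwards [(hc.sub (hφ.differentiableAt l x hx).continuousAt).eventually_ne
        (sub_ne_zero.2 h1)] with w hw _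
      exact sub_ne_zero.1 hw
  filter_upwards [hne, R.root_continues h i, Metric.isOpen_ball.mem_nhds hx] with w h1 h2 h3
  obtain ⟨l, hl⟩ := hφ.exists_eq h3 h2
  by_cases hlk : l = k
  · rw [← hlk]; exact hl
  · exact absurd hl (h1 l hlk)

/-- Continuation within a ball of regular parameters follows the local roots. -/
theorem IsRootSheets.exists_continues (hφ : R.IsRootSheets x₀ r φ)
    (hx : x ∈ Metric.ball x₀ r) (hy : y ∈ Metric.ball x₀ r) (h : T.Continues x Φ) :
    ∃ Ψ, T.Continues y Ψ ∧ ∀ i k, operatorValue a O (fun s => Φ s i) x = φ k x →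
      operatorValue a O (fun s => Ψ s i) y = φ k y := by
  choose l hl using hφ.exists_eventuallyEq hx h
  set Ψ : Fin m → Vac → (Fin n → ℂ) → ℂ := fun s i w =>
    ((R.Q s).map (evalParam a w)).eval (φ (l i) w) / evalParam a w (R.d s) with hΨ
  have hd : ∀ s i, ∀ w ∈ Metric.ball x₀ r, DifferentiableAt ℂ (Ψ s i) w := by
    intro s i w hw
    have hds : DifferentiableAt ℂ (fun w => evalParam a w (R.d s)) w := R.entire _ (R.d s).2 w
    have hQ := R.differentiableAt_eval (R.Q s) (hφ.differentiableAt (l i) w hw)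
    exact (hQ.mul (hds.inv (R.d_ne_zero s w (hφ.regular w hw)))).congr_of_eventuallyEq
      (Eventually.of_forall fun u => div_eq_mul_inv _ _)
  have hΦΨ : ∀ s i, Φ s i =ᶠ[𝓝 x] Ψ s i := by
    intro s i
    filter_upwards [R.rel_continues h s i, hl i, Metric.isOpen_ball.mem_nhds hx] with w h1 h2 h3
    simp only [hΨ]
    rw [eq_div_iff (R.d_ne_zero s w (hφ.regular w h3)), mul_comm, h1, h2]
  have hJ : JoinedIn (Metric.ball x₀ r) x y :=
    ((convex_ball x₀ r).isPathConnected ⟨x, hx⟩).joinedIn x hx y hy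
  refine ⟨Ψ, h.trans hJ.somePath
    (fun t => R.mem_theorySpace _ (hφ.regular _ (hJ.somePath_mem t)))
    (fun s i t => Filter.mem_of_superset (Metric.isOpen_ball.mem_nhds (hJ.somePath_mem t))
      (hd s i)) hΦΨ, fun i k hk => ?_⟩
  have hlk : l i = k := hφ.injective x hx ((hl i).eq_of_nhds.symm.trans hk)
  rw [← hlk]
  exact eq_of_eventuallyEq_of_ball
    (fun w hw => R.differentiableAt_operatorValue fun s => hd s i w hw)
    (hφ.differentiableAt (l i)) hx
    ((operatorValue_congr fun s => (hΦΨ s i).symm).trans (hl i)) hy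

/-- The values at `x` of all the continuations to `x`, along paths in theory space, of the
expectation value of `O` in the vacuum `i`. -/
def sheet (T : ChiralSector n m Vac) (O : MvPolynomial (Fin m) a) (i : Vac) (x : Fin n → ℂ) :
    Set ℂ :=
  {z | ∃ Φ, T.Continues x Φ ∧ operatorValue a O (fun s => Φ s i) x = z}

theorem IsRootSheets.mem_sheet_iff (hφ : R.IsRootSheets x₀ r φ)
    (hx : x ∈ Metric.ball x₀ r) (hy : y ∈ Metric.ball x₀ r) (i k : Vac) :
    φ k x ∈ sheet T O i x ↔ φ k y ∈ sheet T O i y := by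
  constructor
  · rintro ⟨Φ, h, hk⟩
    obtain ⟨Ψ, hΨ, hΨk⟩ := hφ.exists_continues hx hy h
    exact ⟨Ψ, hΨ, hΨk i k hk⟩
  · rintro ⟨Φ, h, hk⟩
    obtain ⟨Ψ, hΨ, hΨk⟩ := hφ.exists_continues hy hx h
    exact ⟨Ψ, hΨ, hΨk i k hk⟩

end RegularLocus
end ChiralSector

/-! ### Symmetric functions of a sheet, and the monodromy orbits -/

theorem differentiableAt_prod {E ι : Type*} [NormedAddCommGroup E] [NormedSpace ℂ E]
    {s : Finset ι} {f : ι → E → ℂ} {x : E} (hf : ∀ k ∈ s, DifferentiableAt ℂ (f k) x) :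
    DifferentiableAt ℂ (fun y => ∏ k ∈ s, f k y) x := by
  classical
  exact (HasFDerivAt.finsetProd fun k hk => (hf k hk).hasFDerivAt).differentiableAt

namespace ChiralSector

variable {n m : ℕ} {Vac : Type*} {T : ChiralSector n m Vac} {a : Subalgebra ℂ ((Fin n → ℂ) → ℂ)}
  {O : MvPolynomial (Fin m) a} {P : a[X]}

open Classical in
/-- The product of `lam - c z` over the roots `z` of the polynomial `P` of `O` at `x` that lie on
the sheet of the vacuum `i`, where `c` is the leading coefficient of `P`. -/
def sheetProduct (T : ChiralSector n m Vac) (O : MvPolynomial (Fin m) a) (P : a[X]) (i : Vac)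
    (lam : ℂ) (x : Fin n → ℂ) : ℂ :=
  ((P.map (evalParam a x)).roots.map fun z =>
    if z ∈ RegularLocus.sheet T O i x then lam - evalParam a x P.leadingCoeff * z else 1).prod

namespace RegularLocus

variable [Fintype Vac] {R : T.RegularLocus a O P}

open Classical in
theorem sheetProduct_eq {x : Fin n → ℂ} (hx : R.D x ≠ 0) {ρ : Vac → ℂ}
    (hρ : P.map (evalParam a x) = C (evalParam a x P.leadingCoeff) * ∏ k, (X - C (ρ k)))
    (i : Vac) (lam : ℂ) :
    sheetProduct T O P i lam x = ∏ k, if ρ k ∈ sheet T O i x then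
      lam - evalParam a x P.leadingCoeff * ρ k else 1 := by
  rw [sheetProduct, hρ, prod_map_roots_C_mul_prod (R.leadingCoeff_ne_zero x hx)]

open Classical in
theorem IsRootSheets.sheetProduct_eq {x₀ x y : Fin n → ℂ} {r : ℝ} {φ : Vac → (Fin n → ℂ) → ℂ}
    (hφ : R.IsRootSheets x₀ r φ) (hx : x ∈ Metric.ball x₀ r) (hy : y ∈ Metric.ball x₀ r)
    (i : Vac) (lam : ℂ) :
    sheetProduct T O P i lam x = ∏ k, if φ k y ∈ sheet T O i y then
      lam - evalParam a x P.leadingCoeff * φ k x else 1 := by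
  rw [RegularLocus.sheetProduct_eq (hφ.regular x hx) (hφ.eq_prod x hx)]
  refine Finset.prod_congr rfl fun k _ => ?_
  rw [if_congr (hφ.mem_sheet_iff hx hy i k) rfl rfl]

variable (R)

theorem differentiableAt_sheetProduct (hdeg : P.degree = (Fintype.card Vac : WithBot ℕ))
    {x₀ : Fin n → ℂ} (hx₀ : R.D x₀ ≠ 0) (i : Vac) (lam : ℂ) :
    DifferentiableAt ℂ (sheetProduct T O P i lam) x₀ := by
  classical
  obtain ⟨r, hr, φ, hφ⟩ := R.exists_isRootSheets hdeg hx₀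
  have h0 : x₀ ∈ Metric.ball x₀ r := Metric.mem_ball_self hr
  have hlc : Differentiable ℂ fun x => evalParam a x P.leadingCoeff :=
    R.entire _ P.leadingCoeff.2
  have hd : DifferentiableAt ℂ (fun x => ∏ k, if φ k x₀ ∈ sheet T O i x₀ then
      lam - evalParam a x P.leadingCoeff * φ k x else 1) x₀ := by
    refine differentiableAt_prod fun k _ => ?_
    by_cases hk : φ k x₀ ∈ sheet T O i x₀
    · simp only [hk, if_true]
      exact ((hlc x₀).mul (hφ.differentiableAt k x₀ h0)).const_sub lam
    · simp only [hk, if_false]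
      exact differentiableAt_const _
  refine hd.congr_of_eventuallyEq ?_
  filter_upwards [Metric.isOpen_ball.mem_nhds h0] with x hx
  exact hφ.sheetProduct_eq hx h0 i lam

/-- Each factor of `sheetProduct`, as a function on the regular locus without any continuity, is
integral over the ring of parameters; hence so is the product. -/
theorem exists_monic_eval_sheetProduct (hdeg : P.degree = (Fintype.card Vac : WithBot ℕ))
    (i : Vac) (lam : ℂ) : ∃ q : a[X], q.Monic ∧ ∀ x, R.D x ≠ 0 →
      (q.map (evalParam a x)).eval (sheetProduct T O P i lam x) = 0 := by
  classical
  choose! ρ _ hρ using fun x (hx : R.D x ≠ 0) => R.exists_roots hdeg hx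
  let U := {x // R.D x ≠ 0}
  let f : a →+* (U → ℂ) := RingHom.pi fun x : U => evalParam a x
  let _ : Algebra a (U → ℂ) := f.toAlgebra
  have haeval : ∀ (q : a[X]) (g : U → ℂ) (x : U),
      aeval g q x = (q.map (evalParam a x)).eval (g x) := by
    intro q g x
    rw [eval_map]
    exact hom_eval₂ q f (Pi.evalRingHom (fun _ : U => ℂ) x) g
  set χ : Vac → U → ℂ := fun k x => if ρ x k ∈ sheet T O i x then 1 else 0 with hχ
  have hχi : ∀ k, IsIntegral a (χ k) := by
    intro k
    refine ⟨X ^ 2 - X, monic_X_pow_sub (by simp), ?_⟩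
    rw [← aeval_def, map_sub, map_pow, aeval_X, sub_eq_zero]
    funext x
    simp only [hχ, Pi.pow_apply]
    split_ifs <;> simp
  have hρi : ∀ k, IsIntegral a (P.leadingCoeff • fun x : U => ρ x k) := by
    intro k
    refine isIntegral_leadingCoeff_smul _ _ ?_
    funext x
    rw [haeval, hρ x x.2, eval_C_mul_prod_X_sub_C,
      Finset.prod_eq_zero (Finset.mem_univ k) (sub_self _), mul_zero]
    rfl
  have hint : IsIntegral a (∏ k, (1 + χ k * (algebraMap a (U → ℂ) (algebraMap ℂ a lam) -
      P.leadingCoeff • (fun x : U => ρ x k) - 1))) :=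
    IsIntegral.prod _ fun k _ => isIntegral_one.add
      ((hχi k).mul ((isIntegral_algebraMap.sub (hρi k)).sub isIntegral_one))
  obtain ⟨q, hq, h⟩ := hint
  refine ⟨q, hq, fun x hx => ?_⟩
  have h1 : _ = (0 : ℂ) := congrFun h ⟨x, hx⟩
  rw [← aeval_def, haeval] at h1
  convert h1 using 2
  rw [sheetProduct_eq hx (hρ x hx), Finset.prod_apply]
  refine Finset.prod_congr rfl fun k _ => ?_
  have e1 : (algebraMap a (U → ℂ) (algebraMap ℂ a lam)) ⟨x, hx⟩ = lam := rfl
  have e2 : (P.leadingCoeff • fun x : U => ρ x k) ⟨x, hx⟩ =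
      evalParam a x P.leadingCoeff * ρ x k := by
    rw [Algebra.smul_def]; rfl
  simp only [Pi.add_apply, Pi.mul_apply, Pi.sub_apply, Pi.one_apply, e1, e2, hχ]
  split_ifs <;> ring

/-- The symmetric functions of a sheet extend to entire functions integral over the ring of
parameters. -/
theorem exists_entire_sheetProduct (hdeg : P.degree = (Fintype.card Vac : WithBot ℕ))
    (i : Vac) (lam : ℂ) : ∃ g : (Fin n → ℂ) → ℂ, Differentiable ℂ g ∧ IsIntegral a g ∧
      ∀ x, R.D x ≠ 0 → g x = sheetProduct T O P i lam x := by
  obtain ⟨q, hq, hqN⟩ := R.exists_monic_eval_sheetProduct hdeg i lam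
  have hqc : ∀ k, Continuous fun x => ‖evalParam a x (q.coeff k)‖ := fun k =>
    (R.entire _ (q.coeff k).2).continuous.norm
  obtain ⟨g, hg, hgN⟩ := exists_entire_extension R.differentiable R.ne_zero
    (fun x hx => R.differentiableAt_sheetProduct hdeg hx i lam) (fun x₀ => by
      have hcont : Continuous fun x => 1 + ∑ k ∈ Finset.range q.natDegree,
          ‖evalParam a x (q.coeff k)‖ :=
        continuous_const.add (continuous_finsetSum _ fun k _ => hqc k)
      refine ⟨1 + ∑ k ∈ Finset.range q.natDegree, ‖evalParam a x₀ (q.coeff k)‖ + 1,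
        (hcont.continuousAt.eventually_lt continuousAt_const
        (lt_add_one (1 + ∑ k ∈ Finset.range q.natDegree, ‖evalParam a x₀ (q.coeff k)‖))).mono
        fun x hx hDx => ?_⟩
      have := (hq.map (evalParam a x)).norm_root_le (hqN x hDx)
      simp only [hq.natDegree_map, coeff_map] at this
      exact this.trans hx.le)
  refine ⟨g, hg, ⟨q, hq, ?_⟩, hgN⟩
  rw [← aeval_def]
  have hcont : Continuous fun x => (q.map (evalParam a x)).eval (g x) :=
    Differentiable.continuous (𝕜 := ℂ) fun x => R.differentiableAt_eval q (hg x)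
  have := Continuous.ext_on (R.differentiable.dense_ne_zero R.ne_zero) hcont continuous_const
    (g := fun _ => 0) fun x hx => by
      simp only
      rw [hgN x hx]
      exact hqN x hx
  funext x
  rw [← eval_map_evalParam_eq]
  exact congrFun this x

omit [Fintype Vac] in
/-- Arbitrarily close to the base point there are regular points joined to it by segments of
regular parameters. -/
theorem exists_path_of_ball {r : ℝ} (hr : 0 < r) : ∃ (b : Fin n → ℂ) (δ : Path T.base b),
    R.D b ≠ 0 ∧ (∀ t, δ t ∈ T.theorySpace) ∧ ∀ t, δ t ∈ Metric.ball T.base r := by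
  obtain ⟨z, hz, hzB⟩ := (R.differentiable.dense_ne_zero R.ne_zero).exists_mem_open
    Metric.isOpen_ball ⟨T.base, Metric.mem_ball_self hr⟩
  set v := z - T.base with hv
  have hvr : ‖v‖ < r := by rwa [Metric.mem_ball, dist_eq_norm] at hzB
  have hev := R.differentiable.eventually_ne_zero_on_line (x₀ := T.base) (v := v) (w₀ := 1)
    (by simpa [hv] using hz) 0
  obtain ⟨ε, hε, hB⟩ := Metric.eventually_nhds_iff_ball.1 (eventually_nhdsWithin_iff.1 hev)
  set t₀ : ℝ := min (ε / 2) 1 with ht₀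
  have ht₀0 : 0 < t₀ := lt_min (by positivity) one_pos
  have hD : ∀ t : ℝ, 0 < t → t ≤ 1 → R.D (T.base + ((t * t₀ : ℝ) : ℂ) • v) ≠ 0 := by
    intro t h0 h1
    refine hB _ ?_ ?_
    · rw [mem_ball_zero_iff, Complex.norm_real, Real.norm_of_nonneg (by positivity)]
      have := min_le_left (ε / 2) 1
      nlinarith
    · have : t * t₀ ≠ 0 := by positivity
      simpa using (Complex.ofReal_ne_zero.2 this)
  have hc : Continuous fun t : unitInterval =>
      T.base + ((((t : ℝ) * t₀ : ℝ)) : ℂ) • v := by fun_prop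
  refine ⟨T.base + ((t₀ : ℝ) : ℂ) • v, ⟨⟨_, hc⟩, by simp, by simp⟩, ?_, fun t => ?_, fun t => ?_⟩
  · simpa using hD 1 one_pos le_rfl
  · rcases t.2.1.lt_or_eq with h | h
    · exact R.mem_theorySpace _ (hD t h t.2.2)
    · change T.base + ((((t : ℝ) * t₀ : ℝ)) : ℂ) • v ∈ _
      rw [← h]
      simpa using T.base_mem
  · change T.base + ((((t : ℝ) * t₀ : ℝ)) : ℂ) • v ∈ _
    rw [mem_ball_iff_norm, add_sub_cancel_left, norm_smul, Complex.norm_real,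
      Real.norm_of_nonneg (mul_nonneg t.2.1 ht₀0.le)]
    have h1 : (t : ℝ) * t₀ ≤ 1 := mul_le_one₀ t.2.2 ht₀0.le (min_le_right _ _)
    have := norm_nonneg v
    nlinarith

include R in
open Classical in
/-- The sheet of the vacuum `i` near the base point: it consists of the expectation values of `O` in
a set `Ω` of vacua in the monodromy orbit of `i`, and the products `∏ j ∈ Ω, (lam - c fⱼ)` are
elements of the field of parameters. -/
theorem exists_finset_orbit (ha : IsRingOfParameters a)
    (hdeg : P.degree = (Fintype.card Vac : WithBot ℕ)) (i : Vac) :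
    ∃ Ω : Finset Vac, i ∈ Ω ∧ (∀ j ∈ Ω, ∃ σ ∈ T.monodromyGroup, σ i = j) ∧
      ∀ lam : ℂ, ∃ c d : a, d ≠ 0 ∧ ∀ᶠ x in 𝓝 T.base, evalParam a x c =
        evalParam a x d * ∏ j ∈ Ω, (lam - evalParam a x P.leadingCoeff * T.expectation a O j x) := by
  obtain ⟨r, hr, hB⟩ := Metric.eventually_nhds_iff_ball.1
    (eventually_all.2 fun s => eventually_all.2 fun i => T.holomorphic s i)
  obtain ⟨b, δ, hDb, hδT, hδB⟩ := R.exists_path_of_ball hr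
  have hnhds : ∀ t, Metric.ball T.base r ∈ 𝓝 (δ t) := fun t => Metric.isOpen_ball.mem_nhds (hδB t)
  have hcont : T.Continues b T.vev := continues_base.trans δ hδT
    (fun s i t => Filter.mem_of_superset (hnhds t) fun w hw => hB w hw s i)
    fun _ _ => EventuallyEq.rfl
  have hbB : b ∈ Metric.ball T.base r := by simpa using hδB 1
  obtain ⟨ε, hε, φ, hφ⟩ := R.exists_isRootSheets hdeg hDb
  have hb : b ∈ Metric.ball b ε := Metric.mem_ball_self hε
  -- near `b`, the expectation values of `O` in the vacua are the local roots, permuted by `l`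
  choose l hl using fun i => hφ.exists_eventuallyEq hb hcont i
  have hexp : ∀ i, (operatorValue a O fun s => T.vev s i) = T.expectation a O i := fun _ => rfl
  simp only [hexp] at hl
  have hlinj : Function.Injective l := fun j k hjk =>
    R.operatorValue_injective hcont ((hl j).trans (hjk ▸ (hl k).symm))
  have hlbij : Function.Bijective l := Finite.injective_iff_bijective.1 hlinj
  have hfinj : ∀ j k, T.expectation a O j b = T.expectation a O k b → j = k := by
    intro j k hjk
    rw [(hl j).eq_of_nhds, (hl k).eq_of_nhds] at hjk
    exact hlinj (hφ.injective b hb hjk)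
  refine ⟨Finset.univ.filter fun j => T.expectation a O j b ∈ sheet T O i b, ?_, ?_, ?_⟩
  · simp only [Finset.mem_filter, Finset.mem_univ, true_and]
    exact ⟨T.vev, hcont, rfl⟩
  · intro j hj
    obtain ⟨Φ, hΦ, hΦj⟩ := (Finset.mem_filter.1 hj).2
    choose l' hl' using fun k => hφ.exists_eventuallyEq hb hΦ k
    choose τ hτ using fun k => hlbij.2 (l' k)
    have hΦτ : ∀ k, operatorValue a O (fun s => Φ s k) =ᶠ[𝓝 b] T.expectation a O (τ k) := fun k =>
      (hl' k).trans (by rw [← hτ k]; exact (hl (τ k)).symm)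
    have hτinj : Function.Injective τ := fun j k hjk =>
      R.operatorValue_injective hΦ ((hΦτ j).trans (hjk ▸ (hΦτ k).symm))
    -- the continuation of the vacua to `b`, brought back to the base point
    have hloop : T.Continues T.base fun s k => T.vev s (τ k) := by
      refine hΦ.trans δ.symm (fun t => hδT _) (fun s k t => ?_) fun s k => ?_
      · exact Filter.mem_of_superset (hnhds _) fun w hw => hB w hw s (τ k)
      · filter_upwards [R.rel_continues hΦ s k, R.rel_continues hcont s (τ k), hΦτ k,
          R.isOpen.mem_nhds hDb] with w h1 h2 h3 h4
        refine mul_left_cancel₀ (R.d_ne_zero s w h4) ?_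
        rw [h1, h2, h3]
        rfl
    refine ⟨Equiv.ofBijective τ (Finite.injective_iff_bijective.1 hτinj),
      Subgroup.subset_closure hloop, ?_⟩
    exact hfinj _ _ ((hΦτ i).eq_of_nhds.symm.trans hΦj)
  · intro lam
    obtain ⟨g, hg, hgi, hgN⟩ := R.exists_entire_sheetProduct hdeg i lam
    obtain ⟨c, hc, d, hd, hd0, hdg⟩ := ha.exists_mul_eq hg hgi
    refine ⟨⟨c, hc⟩, ⟨d, hd⟩, fun h => hd0 (congrArg Subtype.val h), ?_⟩
    have hfd : ∀ k, ∀ w ∈ Metric.ball T.base r, DifferentiableAt ℂ (T.expectation a O k) w :=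
      fun k w hw => R.differentiableAt_operatorValue fun s => hB w hw s k
    have hlc : Differentiable ℂ fun x => evalParam a x P.leadingCoeff :=
      R.entire _ P.leadingCoeff.2
    have hnear : g =ᶠ[𝓝 b] fun x => ∏ j ∈ Finset.univ.filter
        (fun j => T.expectation a O j b ∈ sheet T O i b),
        (lam - evalParam a x P.leadingCoeff * T.expectation a O j x) := by
      filter_upwards [Metric.isOpen_ball.mem_nhds hb, eventually_all.2 hl] with x hx hlx
      rw [hgN x (hφ.regular x hx), hφ.sheetProduct_eq hx hb, Finset.prod_filter]
      refine (Fintype.prod_bijective l hlbij _ _ fun k => ?_).symm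
      rw [(hl k).eq_of_nhds, hlx k]
    have hall : ∀ x ∈ Metric.ball T.base r, g x = ∏ j ∈ Finset.univ.filter
        (fun j => T.expectation a O j b ∈ sheet T O i b),
        (lam - evalParam a x P.leadingCoeff * T.expectation a O j x) := fun x hx =>
      eq_of_eventuallyEq_of_ball (fun w _ => hg w)
        (fun w hw => differentiableAt_prod fun k _ =>
          ((hlc w).mul (hfd k w hw)).const_sub lam) hbB hnear hx
    filter_upwards [Metric.ball_mem_nhds T.base hr] with x hx
    rw [← hall x hx]
    exact (congrFun hdg x).symm

end RegularLocus
end ChiralSector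

/-! ### Orbits of a permutation group on the roots of a polynomial -/

section Orbits

variable {K M Vac : Type*} [Field K] [Field M] [Algebra K M] [Fintype Vac]

/-- A polynomial with as many distinct roots as its degree is separable and splits. -/
theorem separable_and_splits_of_injective_roots {P : K[X]} {F : Vac → M}
    (hF : Function.Injective F) (hdeg : P.degree = (Fintype.card Vac : WithBot ℕ))
    (hroot : ∀ i, aeval (F i) P = 0) :
    P.Separable ∧ (P.map (algebraMap K M)).Splits ∧
      ∀ z, (P.map (algebraMap K M)).IsRoot z → ∃ i, F i = z := by
  classical
  have hP0 : P ≠ 0 := by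
    rintro rfl
    simp at hdeg
  have hP0' : P.map (algebraMap K M) ≠ 0 := (Polynomial.map_ne_zero_iff (algebraMap K M).injective).2 hP0
  have hnat : (P.map (algebraMap K M)).natDegree = Fintype.card Vac := by
    rw [natDegree_map]
    exact natDegree_eq_of_degree_eq_some hdeg
  have hle : (Finset.univ.val.map F) ≤ (P.map (algebraMap K M)).roots := by
    refine (Multiset.le_iff_subset ((Multiset.nodup_map_iff_of_injective hF).2
      Finset.univ.nodup)).2 fun z hz => ?_
    obtain ⟨i, -, rfl⟩ := Multiset.mem_map.1 hz
    rw [mem_roots hP0', IsRoot, eval_map_algebraMap]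
    exact hroot i
  have heq : (Finset.univ.val.map F) = (P.map (algebraMap K M)).roots := by
    refine Multiset.eq_of_le_of_card_le hle ((card_roots' _).trans ?_)
    rw [hnat, Multiset.card_map]
    rfl
  have hs : (P.map (algebraMap K M)).Splits := by
    rw [splits_iff_card_roots, ← heq, hnat, Multiset.card_map]
    rfl
  refine ⟨?_, hs, fun z hz => ?_⟩
  · rw [← separable_map (algebraMap K M), ← nodup_roots_iff_of_splits hP0' hs, ← heq]
    exact (Multiset.nodup_map_iff_of_injective hF).2 Finset.univ.nodup
  · have : z ∈ Finset.univ.val.map F := by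
      rw [heq]
      exact (mem_roots hP0').2 hz
    obtain ⟨i, -, hi⟩ := Multiset.mem_map.1 this
    exact ⟨i, hi⟩

/-- Suppose that the polynomial `P` over `K` has the distinct roots `F i`, that a group of
permutations of the indices preserves the polynomial equations over `K` satisfied by the `F i`, and
that for each `i` some polynomial over `K` vanishes at `F i`, but at no `F j` with `j` outside the
orbit of `i`. Then the orbits correspond to the monic irreducible factors of `P`: the orbit of `i`
to the minimal polynomial of `F i`. -/
theorem exists_orbit_equiv_factors (G : Subgroup (Equiv.Perm Vac)) {P : K[X]} {F : Vac → M}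
    (hF : Function.Injective F) (hdeg : P.degree = (Fintype.card Vac : WithBot ℕ))
    (hroot : ∀ i, aeval (F i) P = 0)
    (hG : ∀ σ ∈ G, ∀ (p : K[X]) (i : Vac), aeval (F i) p = 0 → aeval (F (σ i)) p = 0)
    (hq : ∀ i, ∃ q : K[X], aeval (F i) q = 0 ∧ ∀ j, aeval (F j) q = 0 → ∃ σ ∈ G, σ i = j) :
    ∃ e : MulAction.orbitRel.Quotient G Vac ≃ {p : K[X] // p.Monic ∧ Irreducible p ∧ p ∣ P},
      ∀ φ, (∀ i : Vac, i ∈ φ.orbit ↔ aeval (F i) (e φ : K[X]) = 0) ∧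
        φ.orbit.ncard = (e φ : K[X]).natDegree := by
  classical
  obtain ⟨hsep, hsplit, hall⟩ := separable_and_splits_of_injective_roots hF hdeg hroot
  have hP0 : P ≠ 0 := hsep.ne_zero
  have hint : ∀ i, IsIntegral K (F i) := fun i =>
    IsAlgebraic.isIntegral ⟨P, hP0, hroot i⟩
  have hmem : ∀ i j, (∃ σ ∈ G, σ i = j) ↔ aeval (F j) (minpoly K (F i)) = 0 := by
    intro i j
    constructor
    · rintro ⟨σ, hσ, rfl⟩
      exact hG σ hσ _ _ (minpoly.aeval K (F i))
    · intro h
      obtain ⟨q, hqi, hqj⟩ := hq i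
      obtain ⟨q', rfl⟩ := minpoly.dvd K (F i) hqi
      exact hqj j (by rw [map_mul, h, zero_mul])
  have hmin : ∀ i j, (∃ σ ∈ G, σ i = j) → minpoly K (F i) = minpoly K (F j) := fun i j h =>
    minpoly.eq_of_irreducible_of_monic (minpoly.irreducible (hint i)) ((hmem i j).1 h)
      (minpoly.monic (hint i))
  have hrel : ∀ i j, (MulAction.orbitRel G Vac) i j ↔ ∃ σ ∈ G, σ j = i := by
    intro i j
    rw [MulAction.orbitRel_apply, MulAction.mem_orbit_iff]
    exact ⟨fun ⟨σ, h⟩ => ⟨σ, σ.2, h⟩, fun ⟨σ, hσ, h⟩ => ⟨⟨σ, hσ⟩, h⟩⟩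
  let f : MulAction.orbitRel.Quotient G Vac → {p : K[X] // p.Monic ∧ Irreducible p ∧ p ∣ P} :=
    Quotient.lift (fun i => ⟨minpoly K (F i), minpoly.monic (hint i), minpoly.irreducible (hint i),
      minpoly.dvd K (F i) (hroot i)⟩)
      fun i j h => Subtype.ext (hmin j i ((hrel i j).1 h)).symm
  have hfinj : Function.Injective f := by
    intro φ ψ
    induction φ using Quotient.inductionOn with | _ i => ?_
    induction ψ using Quotient.inductionOn with | _ j => ?_
    intro h
    have h' : minpoly K (F i) = minpoly K (F j) := congrArg Subtype.val h
    refine Quotient.sound ((hrel i j).2 ((hmem j i).2 ?_))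
    rw [← h']
    exact minpoly.aeval K (F i)
  have hroots : ∀ p : K[X], p ∣ P → ∀ z, (p.map (algebraMap K M)).IsRoot z → ∃ i, F i = z :=
    fun p hp z hz => hall z (hz.dvd (Polynomial.map_dvd _ hp))
  have hPM : P.map (algebraMap K M) ≠ 0 :=
    (Polynomial.map_ne_zero_iff (algebraMap K M).injective).2 hP0
  have hsp : ∀ p : K[X], p ∣ P → (p.map (algebraMap K M)).Splits := fun p hp =>
    hsplit.of_dvd hPM (Polynomial.map_dvd _ hp)
  have hfsurj : Function.Surjective f := by
    rintro ⟨p, hpm, hpi, hpP⟩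
    obtain ⟨z, hz⟩ := (hsp p hpP).exists_eval_eq_zero (by
      rw [degree_map]
      exact hpi.degree_pos.ne')
    obtain ⟨i, rfl⟩ := hroots p hpP z hz
    refine ⟨Quotient.mk _ i, Subtype.ext ?_⟩
    rw [eval_map_algebraMap] at hz
    exact (minpoly.eq_of_irreducible_of_monic hpi hz hpm).symm
  refine ⟨Equiv.ofBijective f ⟨hfinj, hfsurj⟩, fun φ => ?_⟩
  induction φ using Quotient.inductionOn with | _ i => ?_
  set S : Set Vac := MulAction.orbitRel.Quotient.orbit (G := G) (Quotient.mk _ i) with hS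
  have h1 : ∀ j, j ∈ S ↔ aeval (F j) (minpoly K (F i)) = 0 := by
    intro j
    rw [← hmem, ← hrel]
    exact Iff.rfl
  refine ⟨h1, ?_⟩
  have hdvd : minpoly K (F i) ∣ P := minpoly.dvd K (F i) (hroot i)
  have hne : (minpoly K (F i)).map (algebraMap K M) ≠ 0 :=
    (Polynomial.map_ne_zero_iff (algebraMap K M).injective).2 (minpoly.ne_zero (hint i))
  have hset : F '' S = ((minpoly K (F i)).map (algebraMap K M)).roots.toFinset := by
    ext z
    simp only [Set.mem_image, h1, Finset.mem_coe, Multiset.mem_toFinset, mem_roots hne]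
    constructor
    · rintro ⟨j, hj, rfl⟩
      rwa [IsRoot, eval_map_algebraMap]
    · intro hz
      obtain ⟨j, rfl⟩ := hroots _ hdvd z hz
      refine ⟨j, ?_, rfl⟩
      rwa [IsRoot, eval_map_algebraMap] at hz
  rw [← Set.ncard_image_of_injective _ hF, hset, Set.ncard_coe_finset,
    Multiset.toFinset_card_of_nodup (nodup_roots ((hsep.of_dvd hdvd).map)),
    ← (hsp _ hdvd).natDegree_eq_card_roots, natDegree_map]
  rfl

/-- A polynomial over `M` whose values at the natural numbers lie in the subfield `K` has its
coefficients in `K`, by Lagrange interpolation. -/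
theorem exists_map_eq_of_eval_natCast [CharZero K] {q : M[X]} {N : ℕ} (hq : q.degree < N)
    (h : ∀ k : ℕ, ∃ c : K, algebraMap K M c = q.eval (k : M)) :
    ∃ p : K[X], p.map (algebraMap K M) = q := by
  choose c hc using h
  have : CharZero M := charZero_of_injective_algebraMap (algebraMap K M).injective
  set p := Lagrange.interpolate (Finset.range N) (fun k : ℕ => (k : K)) c with hp
  refine ⟨p, ?_⟩
  refine eq_of_degrees_lt_of_eval_index_eq (Finset.range N) (v := fun k : ℕ => (k : M))
    (Nat.cast_injective.injOn) ?_ ?_ fun k hk => ?_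
  · rw [degree_map]
    exact Lagrange.degree_interpolate_lt c Nat.cast_injective.injOn
  · rwa [Finset.card_range]
  · have h1 := Lagrange.eval_interpolate_at_node (s := Finset.range N)
      (v := fun k : ℕ => (k : K)) c Nat.cast_injective.injOn hk
    have h2 : (p.map (algebraMap K M)).eval (algebraMap K M (k : K)) = algebraMap K M (c k) := by
      rw [eval_map_apply, h1]
    rw [map_natCast] at h2
    rw [h2, hc]

end Orbits

/-! ### Clearing denominators -/

theorem exists_map_eq_C_mul {A K : Type*} [CommRing A] [Field K] [Algebra A K] [IsFractionRing A K]
    [IsDomain A] (p : K[X]) :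
    ∃ d : A, d ≠ 0 ∧ ∃ Q : A[X], Q.map (algebraMap A K) = C (algebraMap A K d) * p := by
  obtain ⟨d, hd, h⟩ := IsLocalization.integerNormalization_spec (nonZeroDivisors A) p
  refine ⟨d, nonZeroDivisors.ne_zero hd, _, h.trans ?_⟩
  rw [← algebraMap_smul K d p, smul_eq_C_mul]

/-- A separable polynomial over a domain, up to a nonzero constant, satisfies a Bézout identity with
its derivative over the domain. -/
theorem exists_bezout_of_separable_map {A K : Type*} [CommRing A] [Field K] [Algebra A K]
    [IsFractionRing A K] [IsDomain A] {P : A[X]} (hP : (P.map (algebraMap A K)).Separable) :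
    ∃ e : A, e ≠ 0 ∧ ∃ U V : A[X], U * P + V * derivative P = C e := by
  obtain ⟨u, v, huv⟩ := hP
  obtain ⟨d₁, hd₁, U, hU⟩ := exists_map_eq_C_mul (A := A) u
  obtain ⟨d₂, hd₂, V, hV⟩ := exists_map_eq_C_mul (A := A) v
  refine ⟨d₁ * d₂, mul_ne_zero hd₁ hd₂, C d₂ * U, C d₁ * V, ?_⟩
  apply Polynomial.map_injective (algebraMap A K) (IsFractionRing.injective A K)
  simp only [Polynomial.map_add, Polynomial.map_mul, map_C, hU, hV, map_mul, ← derivative_map]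
  linear_combination (C (algebraMap A K d₁) * C (algebraMap A K d₂)) * huv

/-- Membership in an ideal extended from `A[X₁, …]` to `K[X₁, …]`, for polynomials with
coefficients in `A`. -/
theorem exists_C_mul_mem_of_map_mem {A K σ : Type*} [CommRing A] [Field K] [Algebra A K]
    [IsFractionRing A K] [IsDomain A] {I : Ideal (MvPolynomial σ A)} {p : MvPolynomial σ A}
    (hp : MvPolynomial.map (algebraMap A K) p ∈ I.map (MvPolynomial.map (algebraMap A K))) :
    ∃ d : A, d ≠ 0 ∧ MvPolynomial.C d * p ∈ I := by
  let _ : Algebra (MvPolynomial σ A) (MvPolynomial σ K) := MvPolynomial.algebraMvPolynomial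
  have hloc := MvPolynomial.isLocalization (σ := σ) (nonZeroDivisors A) K
  have hp' : algebraMap (MvPolynomial σ A) (MvPolynomial σ K) p ∈
      I.map (algebraMap (MvPolynomial σ A) (MvPolynomial σ K)) := by
    rw [MvPolynomial.algebraMap_def]
    exact hp
  obtain ⟨⟨q, e⟩, h⟩ := (IsLocalization.mem_map_algebraMap_iff
    ((nonZeroDivisors A).map (MvPolynomial.C (σ := σ))) (MvPolynomial σ K)).1 hp'
  obtain ⟨d, hd, hde⟩ := e.2
  refine ⟨d, nonZeroDivisors.ne_zero hd, ?_⟩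
  rw [MvPolynomial.algebraMap_def, ← map_mul] at h
  have h' := MvPolynomial.map_injective _ (IsFractionRing.injective A K) h
  have hqe : p * MvPolynomial.C d = q.1 := by
    rw [← h', ← hde]
  rw [mul_comm, hqe]
  exact q.2

/-! ### The regular locus of a generating operator -/

namespace ChiralSector

variable {n m : ℕ} {Vac : Type*} {T : ChiralSector n m Vac} {a : Subalgebra ℂ ((Fin n → ℂ) → ℂ)}
  {K : Type*} [Field K] [Algebra a K] [IsFractionRing a K] {O : MvPolynomial (Fin m) a}

/-- If `O` generates the chiral ring, the generators are, up to denominators, polynomials in `O`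
modulo the operator relations. -/
theorem exists_relation_of_adjoin_eq_top [IsDomain a]
    (hO : Algebra.adjoin K {T.toChiralRing a K O} = ⊤) (s : Fin m) :
    ∃ d : a, d ≠ 0 ∧ ∃ Q : a[X], MvPolynomial.C d * MvPolynomial.X s - aeval O Q ∈ T.relations a := by
  have hs : (Ideal.Quotient.mk _ (MvPolynomial.X s) : T.ChiralRing a K) ∈
      Algebra.adjoin K {T.toChiralRing a K O} := hO ▸ Algebra.mem_top
  rw [Algebra.adjoin_singleton_eq_range_aeval] at hs
  obtain ⟨q, hq⟩ := hs
  obtain ⟨b, hb, Q, hQ⟩ := exists_map_eq_C_mul (A := a) q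
  have hq' : aeval (T.toChiralRing a K O) q =
      Ideal.Quotient.mk _ (aeval (MvPolynomial.map (algebraMap a K) O) q) :=
    (aeval_algHom_apply (Ideal.Quotient.mkₐ K
      ((T.relations a).map (MvPolynomial.map (algebraMap a K))))
      (MvPolynomial.map (algebraMap a K) O) q)
  have hmem : MvPolynomial.X s - aeval (MvPolynomial.map (algebraMap a K) O) q ∈
      (T.relations a).map (MvPolynomial.map (algebraMap a K)) := by
    rw [← Ideal.Quotient.eq, ← hq', ← hq]
    rfl
  have hmap : MvPolynomial.map (algebraMap a K) (MvPolynomial.C b * MvPolynomial.X s - aeval O Q) =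
      MvPolynomial.C (algebraMap a K b) *
        (MvPolynomial.X s - aeval (MvPolynomial.map (algebraMap a K) O) q) := by
    have h1 : MvPolynomial.map (algebraMap a K) (aeval O Q) =
        aeval (MvPolynomial.map (algebraMap a K) O) (Q.map (algebraMap a K)) := by
      rw [aeval_def, hom_eval₂, aeval_def, eval₂_map]
      congr 1
      ext f
      simp [MvPolynomial.algebraMap_eq]
    rw [map_sub, h1, hQ, map_mul (aeval _), aeval_C, map_mul, MvPolynomial.map_C, MvPolynomial.map_X,
      mul_sub]
    rfl
  obtain ⟨e, he, hmem'⟩ := exists_C_mul_mem_of_map_mem (p := MvPolynomial.C b * MvPolynomial.X s -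
    aeval O Q) (hmap ▸ Ideal.mul_mem_left _ _ hmem)
  refine ⟨e * b, mul_ne_zero he hb, C e * Q, ?_⟩
  convert hmem' using 1
  rw [map_mul (aeval O), aeval_C, map_mul MvPolynomial.C, mul_sub, MvPolynomial.algebraMap_eq]
  ring

theorem expectation_C_mul_X_sub_aeval (d : a) (s : Fin m) (Q : a[X]) (i : Vac) (x : Fin n → ℂ) :
    T.expectation a (MvPolynomial.C d * MvPolynomial.X s - aeval O Q) i x =
      evalParam a x d * T.vev s i x - (Q.map (evalParam a x)).eval (T.expectation a O i x) := by
  have h : T.expectation a (aeval O Q) i x =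
      (Q.map (evalParam a x)).eval (T.expectation a O i x) := by
    have := hom_eval₂ Q (algebraMap a (MvPolynomial (Fin m) a))
      (MvPolynomial.eval₂Hom (evalParam a x) fun s => T.vev s i x) O
    rw [eval_map]
    refine this.trans ?_
    congr 1
    ext f
    simp [MvPolynomial.algebraMap_eq]
  rw [← h]
  simp [expectation, MvPolynomial.eval₂_sub]

theorem isDomain_parameters (a : Subalgebra ℂ ((Fin n → ℂ) → ℂ)) (K : Type*) [Field K] [Algebra a K]
    [IsFractionRing a K] : IsDomain a :=
  (IsFractionRing.injective a K).isDomain (algebraMap a K)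

/-- The expectation values of an operator generating the chiral ring distinguish the vacua. -/
theorem expectation_injective_of_adjoin_eq_top (ha : ∀ f ∈ a, Differentiable ℂ f)
    (hO : Algebra.adjoin K {T.toChiralRing a K O} = ⊤) {i j : Vac}
    (h : T.expectation a O i =ᶠ[𝓝 T.base] T.expectation a O j) : i = j := by
  have := isDomain_parameters a K
  refine T.separated i j fun s => ?_
  obtain ⟨d, hd, Q, hQ⟩ := exists_relation_of_adjoin_eq_top hO s
  have hprod : ∀ᶠ w in 𝓝 T.base, evalParam a w d * (T.vev s i w - T.vev s j w) = 0 := by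
    filter_upwards [hQ i, hQ j, h] with w h1 h2 h3
    rw [expectation_C_mul_X_sub_aeval, sub_eq_zero] at h1 h2
    rw [mul_sub, h1, h2, h3, sub_self]
  have hde : Differentiable ℂ fun w => evalParam a w d := ha _ d.2
  rcases eventuallyEq_zero_or_of_mul (Eventually.of_forall fun w => hde w)
    ((T.holomorphic s i).and (T.holomorphic s j) |>.mono fun w hw => hw.1.sub hw.2) hprod
    with h0 | h0
  · exact absurd (Subtype.ext (hde.eq_zero_of_eventuallyEq_zero h0)) hd
  · exact h0.mono fun w hw => sub_eq_zero.1 hw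

/-- The regular locus exists as soon as `O` generates the chiral ring and `P` is separable. -/
theorem nonempty_regularLocus (ha : IsRingOfParameters a)
    (hO : Algebra.adjoin K {T.toChiralRing a K O} = ⊤) {P : a[X]}
    (hroot : ∀ i, ∀ᶠ x in 𝓝 T.base, (P.map (evalParam a x)).eval (T.expectation a O i x) = 0)
    (hP : (P.map (algebraMap a K)).Separable) : Nonempty (T.RegularLocus a O P) := by
  have := isDomain_parameters a K
  obtain ⟨D₀, hD₀, hD₀0, hD₀T⟩ := T.generic
  choose d hd Q hQ using exists_relation_of_adjoin_eq_top hO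
  obtain ⟨e, he, U, V, hUV⟩ := exists_bezout_of_separable_map hP
  have hP0 : P ≠ 0 := by
    rintro rfl
    simpa using hP.ne_zero
  set w : a := P.leadingCoeff * e * ∏ s, d s with hw
  have hw0 : w ≠ 0 := mul_ne_zero (mul_ne_zero (leadingCoeff_ne_zero.2 hP0) he)
    (Finset.prod_ne_zero_iff.2 fun s _ => hd s)
  have hwd : Differentiable ℂ fun x => evalParam a x w := ha.entire _ w.2
  have hwx : ∀ x, D₀ x * evalParam a x w ≠ 0 → evalParam a x P.leadingCoeff ≠ 0 ∧
      evalParam a x e ≠ 0 ∧ ∀ s, evalParam a x (d s) ≠ 0 := by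
    intro x hx
    have h := right_ne_zero_of_mul hx
    rw [hw, map_mul, map_mul, map_prod] at h
    exact ⟨left_ne_zero_of_mul (left_ne_zero_of_mul h), right_ne_zero_of_mul
      (left_ne_zero_of_mul h), fun s => Finset.prod_ne_zero_iff.1 (right_ne_zero_of_mul h) s
        (Finset.mem_univ s)⟩
  refine ⟨{
    entire := ha.entire
    D := fun x => D₀ x * evalParam a x w
    differentiable := hD₀.mul hwd
    ne_zero := fun h => ?_
    mem_theorySpace := fun x hx => hD₀T x (left_ne_zero_of_mul hx)
    leadingCoeff_ne_zero := fun x hx => (hwx x hx).1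
    separable := fun x hx => ?_
    root := hroot
    injective := fun i j h => expectation_injective_of_adjoin_eq_top ha.entire hO h
    d := d
    d_ne_zero := fun s x hx => (hwx x hx).2.2 s
    Q := Q
    rel := fun s i => (hQ s i).mono fun x hx => ?_ }⟩
  · rcases eventuallyEq_zero_or_of_mul (c := T.base) (Eventually.of_forall fun z => hD₀ z)
      (Eventually.of_forall fun z => hwd z) (Eventually.of_forall fun z => congrFun h z) with h | h
    · exact hD₀0 (hD₀.eq_zero_of_eventuallyEq_zero h)
    · exact hw0 (Subtype.ext (hwd.eq_zero_of_eventuallyEq_zero h))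
  · have h := congrArg (Polynomial.map (evalParam a x)) hUV
    rw [Polynomial.map_add, Polynomial.map_mul, Polynomial.map_mul, map_C, ← derivative_map] at h
    have hinv : C (evalParam a x e)⁻¹ * C (evalParam a x e) = (1 : ℂ[X]) := by
      rw [← C_mul, inv_mul_cancel₀ (hwx x hx).2.1, C_1]
    refine ⟨C (evalParam a x e)⁻¹ * U.map (evalParam a x),
      C (evalParam a x e)⁻¹ * V.map (evalParam a x), ?_⟩
    rw [mul_assoc, mul_assoc, ← mul_add, h, hinv]
  · rw [expectation_C_mul_X_sub_aeval, sub_eq_zero] at hx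
    exact hx

end ChiralSector

/-! ### The field of germs of meromorphic functions at the base point -/

/-- The ring of germs at `b` of holomorphic functions, as germs of functions that are differentiable
near `b`. -/
def holomorphicGerms {n : ℕ} (b : Fin n → ℂ) : Subring (Germ (𝓝 b) ℂ) where
  carrier := {γ | ∃ f : (Fin n → ℂ) → ℂ, (∀ᶠ z in 𝓝 b, DifferentiableAt ℂ f z) ∧ (f : Germ (𝓝 b) ℂ) = γ}
  zero_mem' := ⟨0, Eventually.of_forall fun _ => differentiableAt_const _, rfl⟩
  one_mem' := ⟨1, Eventually.of_forall fun _ => differentiableAt_const _, rfl⟩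
  add_mem' := by
    rintro _ _ ⟨f, hf, rfl⟩ ⟨g, hg, rfl⟩
    exact ⟨f + g, (hf.and hg).mono fun z hz => hz.1.add hz.2, rfl⟩
  mul_mem' := by
    rintro _ _ ⟨f, hf, rfl⟩ ⟨g, hg, rfl⟩
    exact ⟨f * g, (hf.and hg).mono fun z hz => hz.1.mul hz.2, rfl⟩
  neg_mem' := by
    rintro _ ⟨f, hf, rfl⟩
    exact ⟨-f, hf.mono fun z hz => hz.neg, rfl⟩

instance {n : ℕ} (b : Fin n → ℂ) : IsDomain (holomorphicGerms b) := by
  have : NoZeroDivisors (holomorphicGerms b) := by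
    refine ⟨?_⟩
    rintro ⟨_, f, hf, rfl⟩ ⟨_, g, hg, rfl⟩ h
    have h' : ((f * g : (Fin n → ℂ) → ℂ) : Germ (𝓝 b) ℂ) = (0 : (Fin n → ℂ) → ℂ) :=
      congrArg Subtype.val h
    rcases eventuallyEq_zero_or_of_mul hf hg (Germ.coe_eq.1 h') with h0 | h0
    · exact Or.inl (Subtype.ext (Germ.coe_eq.2 h0))
    · exact Or.inr (Subtype.ext (Germ.coe_eq.2 h0))
  exact NoZeroDivisors.to_isDomain _

/-- The germ at the base point of a parameter. -/
def paramGerm {n : ℕ} {a : Subalgebra ℂ ((Fin n → ℂ) → ℂ)} (ha : ∀ f ∈ a, Differentiable ℂ f)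
    (b : Fin n → ℂ) : a →+* holomorphicGerms b :=
  ((Germ.coeRingHom (𝓝 b)).comp a.val.toRingHom).codRestrict _ fun f =>
    ⟨f, Eventually.of_forall fun z => ha f f.2 z, rfl⟩

section GermField

variable {n : ℕ} {a : Subalgebra ℂ ((Fin n → ℂ) → ℂ)} (ha : ∀ f ∈ a, Differentiable ℂ f)
  (b : Fin n → ℂ)

theorem paramGerm_injective : Function.Injective (paramGerm ha b) := by
  refine (injective_iff_map_eq_zero _).2 fun f hf => ?_
  have h : ((f : (Fin n → ℂ) → ℂ) : Germ (𝓝 b) ℂ) = (0 : (Fin n → ℂ) → ℂ) :=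
    congrArg Subtype.val hf
  exact Subtype.ext ((ha f f.2).eq_zero_of_eventuallyEq_zero (Germ.coe_eq.1 h))

variable {b}

/-- The germ at `b` of a function holomorphic near `b`. -/
def holomorphicGerm {f : (Fin n → ℂ) → ℂ} (hf : ∀ᶠ z in 𝓝 b, DifferentiableAt ℂ f z) :
    holomorphicGerms b :=
  ⟨(f : Germ (𝓝 b) ℂ), f, hf, rfl⟩

theorem holomorphicGerm_inj {f g : (Fin n → ℂ) → ℂ} {hf : ∀ᶠ z in 𝓝 b, DifferentiableAt ℂ f z}
    {hg : ∀ᶠ z in 𝓝 b, DifferentiableAt ℂ g z} :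
    holomorphicGerm hf = holomorphicGerm hg ↔ f =ᶠ[𝓝 b] g :=
  Subtype.ext_iff.trans Germ.coe_eq

theorem eval₂_paramGerm {f : (Fin n → ℂ) → ℂ} (hf : ∀ᶠ z in 𝓝 b, DifferentiableAt ℂ f z)
    (Q : a[X]) : eval₂ (paramGerm ha b) (holomorphicGerm hf) Q = 0 ↔
      ∀ᶠ x in 𝓝 b, (Q.map (evalParam a x)).eval (f x) = 0 := by
  have e1 := hom_eval₂ Q (paramGerm ha b) (holomorphicGerms b).subtype (holomorphicGerm hf)
  have e2 := hom_eval₂ Q (algebraMap a ((Fin n → ℂ) → ℂ)) (Germ.coeRingHom (𝓝 b)) f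
  have e3 : (holomorphicGerms b).subtype (eval₂ (paramGerm ha b) (holomorphicGerm hf) Q) =
      ((aeval f Q : (Fin n → ℂ) → ℂ) : Germ (𝓝 b) ℂ) := e1.trans e2.symm
  rw [← map_eq_zero_iff _ (holomorphicGerms b).subtype_injective, e3, ← Germ.coe_zero, Germ.coe_eq]
  exact eventually_congr (Eventually.of_forall fun x => by
    rw [eval_map_evalParam_eq]; rfl)

variable {K : Type*} [Field K] [Algebra a K] [IsFractionRing a K] (M : Type*) [Field M]
  [Algebra (holomorphicGerms b) M] [IsFractionRing (holomorphicGerms b) M]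

variable (K b) in
/-- The embedding of the field of parameters in the field of germs of meromorphic functions. -/
def fieldGerm : K →+* M :=
  IsFractionRing.lift (A := a) (g := (algebraMap (holomorphicGerms b) M).comp (paramGerm ha b))
    ((IsFractionRing.injective (holomorphicGerms b) M).comp (paramGerm_injective ha b))

theorem fieldGerm_algebraMap (c : a) :
    fieldGerm ha b K M (algebraMap a K c) = algebraMap (holomorphicGerms b) M (paramGerm ha b c) :=
  IsFractionRing.lift_algebraMap _ c

theorem eval₂_fieldGerm_eq_zero_iff {f : (Fin n → ℂ) → ℂ}
    (hf : ∀ᶠ z in 𝓝 b, DifferentiableAt ℂ f z) (Q : a[X]) :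
    (Q.map (algebraMap a K)).eval₂ (fieldGerm ha b K M) (algebraMap _ M (holomorphicGerm hf)) = 0 ↔
      ∀ᶠ x in 𝓝 b, (Q.map (evalParam a x)).eval (f x) = 0 := by
  have h1 : (fieldGerm ha b K M).comp (algebraMap a K) =
      (algebraMap (holomorphicGerms b) M).comp (paramGerm ha b) := by
    refine RingHom.ext fun c => ?_
    rw [RingHom.comp_apply, RingHom.comp_apply, fieldGerm_algebraMap]
  have h2 : (Q.map (algebraMap a K)).eval₂ (fieldGerm ha b K M)
      (algebraMap _ M (holomorphicGerm hf)) =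
      algebraMap _ M (eval₂ (paramGerm ha b) (holomorphicGerm hf) Q) := by
    rw [eval₂_map, h1, hom_eval₂]
  rw [h2]
  exact (map_eq_zero_iff _ (IsFractionRing.injective (holomorphicGerms b) M)).trans
    (eval₂_paramGerm ha hf Q)

end GermField

/-! ### Monodromy invariance of algebraic relations -/

namespace ChiralSector

variable {n m : ℕ} {Vac : Type*} {T : ChiralSector n m Vac} {a : Subalgebra ℂ ((Fin n → ℂ) → ℂ)}
  {K : Type*} [Field K] [Algebra a K] [IsFractionRing a K] {O : MvPolynomial (Fin m) a}

theorem isRootNearBase_iff (ha : ∀ f ∈ a, Differentiable ℂ f) (M : Type*) [Field M]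
    [Algebra (holomorphicGerms T.base) M] [IsFractionRing (holomorphicGerms T.base) M]
    {f : (Fin n → ℂ) → ℂ} (hf : ∀ᶠ z in 𝓝 T.base, DifferentiableAt ℂ f z) (p : K[X]) :
    T.IsRootNearBase a p f ↔
      p.eval₂ (fieldGerm ha T.base K M) (algebraMap _ M (holomorphicGerm hf)) = 0 := by
  have := isDomain_parameters a K
  have hmul : ∀ d : a, d ≠ 0 → ((C (algebraMap a K d) * p).eval₂ (fieldGerm ha T.base K M)
      (algebraMap _ M (holomorphicGerm hf)) = 0 ↔
        p.eval₂ (fieldGerm ha T.base K M) (algebraMap _ M (holomorphicGerm hf)) = 0) := by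
    intro d hd
    rw [eval₂_mul, eval₂_C, mul_eq_zero, or_iff_right]
    rw [map_eq_zero_iff _ (fieldGerm ha T.base K M).injective,
      map_eq_zero_iff _ (IsFractionRing.injective a K)]
    exact hd
  constructor
  · rintro ⟨d, hd, Q, hQ, h⟩
    rw [← hmul d hd, ← hQ, eval₂_fieldGerm_eq_zero_iff]
    exact h
  · intro h
    obtain ⟨d, hd, Q, hQ⟩ := exists_map_eq_C_mul (A := a) p
    refine ⟨d, hd, Q, hQ, ?_⟩
    rw [← eval₂_fieldGerm_eq_zero_iff (K := K) ha M hf, hQ, hmul d hd]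
    exact h

/-- Monodromy preserves the algebraic relations of the expectation values over the field of
parameters. -/
theorem isRootNearBase_monodromy_iff [Finite Vac] {K : Type*} [Field K] [Algebra a K]
     (ha : ∀ f ∈ a, Differentiable ℂ f)
    {σ : Equiv.Perm Vac} (hσ : σ ∈ T.monodromyGroup) (p : K[X]) (i : Vac) :
    T.IsRootNearBase a p (T.expectation a O i) ↔
      T.IsRootNearBase a p (T.expectation a O (σ i)) := by
  induction hσ using Subgroup.closure_induction generalizing i with
  | mem σ hσ =>
    have hσ' : T.Continues T.base fun s i => T.vev s (σ i) := hσ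
    refine exists_congr fun d => and_congr_right fun _ => exists_congr fun Q => and_congr_right
      fun _ => ?_
    exact hσ'.relation_iff (fun w c => (Q.map (evalParam a w)).eval
      (MvPolynomial.eval₂ (evalParam a w) (fun s => c s i) O)) fun _ _ hG =>
        differentiableAt_eval_map_evalParam ha Q
          (differentiableAt_eval₂_evalParam ha O fun s => hG s i)
  | one => rfl
  | mul σ τ _ _ hσ hτ => exact (hτ i).trans (hσ (τ i))
  | inv σ _ hσ =>
    have := (hσ (σ⁻¹ i)).symm
    simpa using this

theorem expectation_differentiableAt (ha : ∀ f ∈ a, Differentiable ℂ f) (i : Vac) :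
    ∀ᶠ z in 𝓝 T.base, DifferentiableAt ℂ (T.expectation a O i) z :=
  (eventually_all.2 fun s => T.holomorphic s i).mono fun _ hz =>
    differentiableAt_eval₂_evalParam ha O hz

end ChiralSector

/-! ### Phases and irreducible factors -/

namespace ChiralSector

variable {n m : ℕ} {Vac : Type*} {T : ChiralSector n m Vac} {a : Subalgebra ℂ ((Fin n → ℂ) → ℂ)}
  {K : Type*} [Field K] [Algebra a K] [IsFractionRing a K] {O : MvPolynomial (Fin m) a}

/-- Transitivity of the monodromy: a polynomial over the field of parameters that vanishes at the
expectation value of `O` in the vacuum `i`, and at no vacuum outside the orbit of `i`. It is the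
product of the linear factors belonging to a sheet; its values at numbers, and so its coefficients,
lie in the field of parameters. -/
theorem exists_polynomial_of_orbit [Fintype Vac] {P : a[X]} (R : T.RegularLocus a O P)
    (ha : IsRingOfParameters a) (hdeg : P.degree = (Fintype.card Vac : WithBot ℕ))
    (M : Type*) [Field M] [Algebra (holomorphicGerms T.base) M]
    [IsFractionRing (holomorphicGerms T.base) M]
    {F : Vac → M} (hF : ∀ i, F i = algebraMap (holomorphicGerms T.base) M
      (holomorphicGerm (expectation_differentiableAt (O := O) ha.entire i)))
    (hFinj : Function.Injective F) (i : Vac) :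
    ∃ q : K[X], q.eval₂ (fieldGerm ha.entire T.base K M) (F i) = 0 ∧
      ∀ j, q.eval₂ (fieldGerm ha.entire T.base K M) (F j) = 0 →
        ∃ σ ∈ T.monodromyGroup, σ i = j := by
  have := isDomain_parameters a K
  let _ : Algebra K M := (fieldGerm ha.entire T.base K M).toAlgebra
  have halg : ∀ c : a, algebraMap K M (algebraMap a K c) =
      algebraMap (holomorphicGerms T.base) M (paramGerm ha.entire T.base c) :=
    fun c => fieldGerm_algebraMap ha.entire M c
  have : CharZero a := charZero_of_injective_algebraMap (algebraMap ℂ a).injective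
  have : CharZero K := charZero_of_injective_algebraMap (IsFractionRing.injective a K)
  obtain ⟨Ω, hi, hΩ, hval⟩ := R.exists_finset_orbit ha hdeg i
  have hlc : algebraMap K M (algebraMap a K P.leadingCoeff) ≠ 0 := by
    rw [map_ne_zero_iff _ (algebraMap K M).injective,
      map_ne_zero_iff _ (IsFractionRing.injective a K)]
    refine leadingCoeff_ne_zero.2 fun h => ?_
    rw [h] at hdeg
    simp at hdeg
  set c₀ := algebraMap K M (algebraMap a K P.leadingCoeff) with hc₀
  set q₀ : M[X] := ∏ j ∈ Ω, (X - C (c₀ * F j)) with hq₀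
  have hq₀deg : q₀.degree < ((Ω.card + 1 : ℕ) : WithBot ℕ) := by
    rw [hq₀, degree_prod]
    simp only [degree_X_sub_C, Finset.sum_const, nsmul_one]
    exact_mod_cast Nat.lt_succ_self _
  have hroot₀ : ∀ j, q₀.eval (c₀ * F j) = 0 ↔ j ∈ Ω := by
    intro j
    rw [hq₀, eval_prod, Finset.prod_eq_zero_iff]
    constructor
    · rintro ⟨k, hk, h⟩
      rw [eval_sub, eval_X, eval_C, sub_eq_zero] at h
      rwa [hFinj (mul_left_cancel₀ hlc h)]
    · intro hj
      exact ⟨j, hj, by simp⟩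
  obtain ⟨p, hp⟩ : ∃ p : K[X], p.map (algebraMap K M) = q₀ := by
    refine exists_map_eq_of_eval_natCast hq₀deg fun k => ?_
    obtain ⟨c, d, hd, hcd⟩ := hval k
    have hgerm : paramGerm ha.entire T.base c = paramGerm ha.entire T.base d *
        ∏ j ∈ Ω, ((k : holomorphicGerms T.base) - paramGerm ha.entire T.base P.leadingCoeff *
          holomorphicGerm (expectation_differentiableAt (O := O) ha.entire j)) := by
      apply (holomorphicGerms T.base).subtype_injective
      rw [map_mul, map_prod]
      simp only [map_sub, map_mul, map_natCast]
      have h1 : Germ.coeRingHom (𝓝 T.base) (c : (Fin n → ℂ) → ℂ) =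
          Germ.coeRingHom (𝓝 T.base) ((d : (Fin n → ℂ) → ℂ) * ∏ j ∈ Ω,
            ((k : (Fin n → ℂ) → ℂ) - (P.leadingCoeff : (Fin n → ℂ) → ℂ) *
              T.expectation a O j)) := by
        refine Germ.coe_eq.2 (hcd.mono fun x hx => ?_)
        simpa using hx
      rw [map_mul, map_prod] at h1
      simp only [map_sub, map_mul, map_natCast] at h1
      exact h1
    have hgerm' := congrArg (algebraMap (holomorphicGerms T.base) M) hgerm
    rw [map_mul, map_prod] at hgerm'
    simp only [map_sub, map_mul, map_natCast, ← halg, ← hF, ← hc₀] at hgerm'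
    have hd' : algebraMap K M (algebraMap a K d) ≠ 0 := by
      rw [map_ne_zero_iff _ (algebraMap K M).injective,
        map_ne_zero_iff _ (IsFractionRing.injective a K)]
      exact hd
    refine ⟨algebraMap a K c / algebraMap a K d, ?_⟩
    rw [map_div₀, div_eq_iff hd', hgerm', hq₀, eval_prod, mul_comm]
    simp
  have hq : ∀ j, (p.comp (C (algebraMap a K P.leadingCoeff) * X)).eval₂
      (fieldGerm ha.entire T.base K M) (F j) = q₀.eval (c₀ * F j) := by
    intro j
    rw [← hp, eval_map, eval₂_comp, eval₂_mul, eval₂_C, eval₂_X]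
    rfl
  refine ⟨p.comp (C (algebraMap a K P.leadingCoeff) * X), ?_, fun j hj => ?_⟩
  · rw [hq, hroot₀]
    exact hi
  · rw [hq, hroot₀] at hj
    exact hΩ j hj

end ChiralSector

end

theorem mainTheorem4 {n m : ℕ} {Vac : Type*} [Fintype Vac] (T : ChiralSector n m Vac)
    (a : Subalgebra ℂ ((Fin n → ℂ) → ℂ)) (ha : IsRingOfParameters a)
    (K : Type*) [Field K] [Algebra a K] [IsFractionRing a K]
    -- the chiral ring is generated by the single chiral operator `O`
    (O : MvPolynomial (Fin m) a)
    (hO : Algebra.adjoin K {T.toChiralRing a K O} = ⊤)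
    -- the polynomial of `O`: its degree is the number of vacua, and the expectation values of `O`
    -- in the vacua satisfy it
    (P : Polynomial a) (hdeg : P.degree = (Fintype.card Vac : WithBot ℕ))
    (hroot : ∀ i, ∀ᶠ x in nhds T.base,
      (P.map (evalParam a x)).eval (T.expectation a O i x) = 0) :
    Squarefree (P.map (algebraMap a K)) ∧
    ∃ e : T.Phase ≃
        {p : Polynomial K // p.Monic ∧ Irreducible p ∧ p ∣ P.map (algebraMap a K)},
      ∀ φ : T.Phase,
        (∀ i : Vac, i ∈ φ.orbit ↔
          T.IsRootNearBase a (e φ : Polynomial K) (T.expectation a O i)) ∧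
        φ.orbit.ncard = (e φ : Polynomial K).natDegree := by
  let M := FractionRing (holomorphicGerms T.base)
  let _ : Algebra K M := (fieldGerm ha.entire T.base K M).toAlgebra
  have hd := fun i => ChiralSector.expectation_differentiableAt (T := T) (O := O) ha.entire i
  let F : Vac → M := fun i => algebraMap (holomorphicGerms T.base) M (holomorphicGerm (hd i))
  have hFinj : Function.Injective F := fun i j h =>
    ChiralSector.expectation_injective_of_adjoin_eq_top ha.entire hO
      (holomorphicGerm_inj.1 (IsFractionRing.injective (holomorphicGerms T.base) M h))
  have hiff : ∀ (p : Polynomial K) (i : Vac), Polynomial.aeval (F i) p = 0 ↔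
      T.IsRootNearBase a p (T.expectation a O i) := fun p i =>
    (ChiralSector.isRootNearBase_iff ha.entire M (hd i) p).symm
  have hdegK : (P.map (algebraMap a K)).degree = (Fintype.card Vac : WithBot ℕ) := by
    rw [Polynomial.degree_map_eq_of_injective (IsFractionRing.injective a K), hdeg]
  have hrootM : ∀ i, Polynomial.aeval (F i) (P.map (algebraMap a K)) = 0 := fun i =>
    (eval₂_fieldGerm_eq_zero_iff ha.entire M (hd i) P).2 (hroot i)
  have hsep := (separable_and_splits_of_injective_roots hFinj hdegK hrootM).1
  obtain ⟨R⟩ := ChiralSector.nonempty_regularLocus ha hO hroot hsep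
  refine ⟨hsep.squarefree, ?_⟩
  obtain ⟨e, he⟩ := exists_orbit_equiv_factors T.monodromyGroup hFinj hdegK hrootM
    (fun σ hσ p i h => (hiff p (σ i)).2
      ((ChiralSector.isRootNearBase_monodromy_iff ha.entire hσ p i).1 ((hiff p i).1 h)))
    (fun i => ChiralSector.exists_polynomial_of_orbit R ha hdeg M (fun _ => rfl) hFinj i)
  exact ⟨e, fun φ => ⟨fun i => ((he φ).1 i).trans (hiff _ i), (he φ).2⟩⟩
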